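/- **Theorem 2 (Asymptotic normality).** Let $p,M\ge 1$ be fixed integers, $\theta\in\mathbb R^p$, and let $(X_i,\varepsilon_i)$, $i=1,2,\dots$, be independent and identically distributed with $X_i\in\mathbb R^p$ and $\varepsilon_i\in\mathbb R$, where $\varepsilon_i$ is independent of $X_i$, has mean $0$ and finite variance $\sigma_\varepsilon^2$. Assume that the entries of $X_i$ are sub-gaussian, i.e. there is $K>0$ with $P(|X_{ij}|>u)\le\exp(1-u^2/K^2)$ for all $i,j$ and $u>0$, and that $\Sigma_{xx}=E(X_1X_1^\top)$ (the covariance matrix of $X_1$ if $E X_1=0$) is positive definite, with largest eigenvalue $\lambda_1(\Sigma_{xx})$. Put $Y_i=X_i^\top\theta+\varepsilon_i$. For $N=nM$, let $\{1,\dots,N\}$ be divided into $M$ disjoint mini-batches $\mathbb S^{(1)},\dots,\mathbb S^{(M)}$ of size $n$, deterministically or at random but independently of the data. Fixed mini-batch gradient descent (FMGD) with learning rate $\alpha>0$ and an arbitrary (possibly random) initial value runs in every epoch $t$ through the mini-batches $m=1,\dots,M$ in this order and replaces the current value $\vartheta$ by $\vartheta-\alpha n^{-1}\sum_{i\in\mathbb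 S^{(m)}}X_i(X_i^\top\vartheta-Y_i)$; the result is $\hat\theta^{(t,m)}$. The FMGD estimator of mini-batch $m$ is $\hat\theta^{(m)}=\lim_{t\to\infty}\hat\theta^{(t,m)}$ (and $0$ if there is no limit). Let $\hat\mu_m(\alpha)$ be its conditional mean (the mean of its regular conditional distribution) given the covariates $X_1,\dots,X_N$ and the mini-batches. Then for every $1\le m\le M$ there is a matrix function $v_m(\alpha)$, not depending on $N$ and positive definite for $0<\alpha<2/\lambda_1(\Sigma_{xx})$, such that 1. $\hat\mu_m(\alpha)=\theta+O_p(\alpha^2n^{-3/2})$ as $n\to\infty$, uniformly over $\alpha\in(0,a]$ for each $a<2/\lambda_1(\Sigma_{xx})$: for every $\delta>0$ there is $C$ such that for all large $n$ and all $\alpha\in(0,a]$, $P\big(\|\hat\mu_m(\alpha)-\theta\|>C\alpha^2n^{-3/2}\big)\le\delta$; 2. $v_m(\alpha)=\Sigma_{xx}^{-1}+\dfrac{\alpha^2(M^2-1)}{12}\Sigma_{xx}+o(\alpha^2)$ as $\alpha\downarrow 0$; 3. for every fixed $0<\alpha<2/\lambda_1(\Sigma_{xx})$, as $N=nM\to\infty$,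 $$\sqrt N\,\{v_m(\alpha)\}^{-1/2}\{\hat\theta^{(m)}-\hat\mu_m(\alpha)\}\to_d N(0,\sigma_\varepsilon^2I_p),$$ both unconditionally and conditionally on the covariates and the mini-batches (the conditional distributions converge weakly, almost surely). So the asymptotic variance of $\sqrt N\,\hat\theta^{(m)}$ exceeds that of the OLS estimator, $\sigma_\varepsilon^2\Sigma_{xx}^{-1}$, by $\alpha^2\sigma_\varepsilon^2(M^2-1)\Sigma_{xx}/12+o(\alpha^2)$. -/

import Mathlib

open MeasureTheory ProbabilityTheory Filter Topology
open scoped RealInnerProductSpace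

noncomputable section

namespace FMGD

/-- `ℝᵖ` with the Euclidean norm. -/
abbrev Vec (p : ℕ) : Type := EuclideanSpace ℝ (Fin p)

/-- The gradient at `ϑ` of the loss `n⁻¹ ∑_{i in batch m} (y_i - x_iᵀ ϑ)² / 2` of the `m`-th
mini-batch, where `b i` is the label of the mini-batch that contains the sample `i`, and `n` is the
size of that mini-batch. In matrix form it is `Σ̂_xx^(m) ϑ - Σ̂_xy^(m)`. -/
def batchGrad {p N M : ℕ} (x : Fin N → Vec p) (y : Fin N → ℝ) (b : Fin N → Fin M)
    (m : Fin M) (ϑ : Vec p) : Vec p :=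
  ((Finset.univ.filter fun i => b i = m).card : ℝ)⁻¹ •
    ∑ i ∈ Finset.univ.filter fun i => b i = m, (⟪x i, ϑ⟫ - y i) • x i

/-- The iterates of fixed mini-batch gradient descent with learning rate `α` and initial value `ϑ₀`,
numbered consecutively: update number `s + 1` uses mini-batch number `s mod M`, so every epoch runs
through the mini-batches `0, …, M - 1` in this order. -/
def iter {p N M : ℕ} [NeZero M] (α : ℝ) (x : Fin N → Vec p) (y : Fin N → ℝ)
    (b : Fin N → Fin M) (ϑ₀ : Vec p) : ℕ → Vec p
  | 0 => ϑ₀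
  | s + 1 => iter α x y b ϑ₀ s - α • batchGrad x y b (Fin.ofNat M s) (iter α x y b ϑ₀ s)

/-- The iterate after the update on mini-batch `m` in epoch number `t` (both counted from `0`). -/
def epochIter {p N M : ℕ} [NeZero M] (α : ℝ) (x : Fin N → Vec p) (y : Fin N → ℝ)
    (b : Fin N → Fin M) (ϑ₀ : Vec p) (m : Fin M) (t : ℕ) : Vec p :=
  iter α x y b ϑ₀ (t * M + m + 1)

open Classical in
/-- The FMGD estimator of mini-batch `m`: the limit of the iterates of mini-batch `m` as the number
of epochs tends to infinity (and `0` if the algorithm does not converge). -/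
def estimator {p N M : ℕ} [NeZero M] (α : ℝ) (x : Fin N → Vec p) (y : Fin N → ℝ)
    (b : Fin N → Fin M) (ϑ₀ : Vec p) (m : Fin M) : Vec p :=
  if h : ∃ l : Vec p, Tendsto (epochIter α x y b ϑ₀ m) atTop (𝓝 l) then h.choose else 0

/-- The largest eigenvalue of a symmetric real matrix. -/
def lambdaMax {p : ℕ} (A : Matrix (Fin p) (Fin p) ℝ) : ℝ := sSup (spectrum ℝ A)

/-- `A ^ (-1/2)` for a positive definite matrix `A`, by the functional calculus. -/
def invSqrt {p : ℕ} (A : Matrix (Fin p) (Fin p) ℝ) : Matrix (Fin p) (Fin p) ℝ :=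
  cfc (fun r : ℝ => r ^ (-(1 / 2) : ℝ)) A

section Model

variable {Ω : Type*} [MeasurableSpace Ω] {p M : ℕ}

/-- The matrix `Σ_xx = E[X₀ X₀ᵀ]`. -/
def secondMoment (P : Measure Ω) (X : ℕ → Ω → Vec p) : Matrix (Fin p) (Fin p) ℝ :=
  Matrix.of fun j k => ∫ ω, X 0 ω j * X 0 ω k ∂P

/-- The covariates of a sample of size `N`, together with its division into mini-batches. -/
def design {N : ℕ} (X : ℕ → Ω → Vec p) (B : Ω → Fin N → Fin M) (ω : Ω) :
    (Fin N → Vec p) × (Fin N → Fin M) :=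
  (fun i => X i ω, B ω)

/-- The FMGD estimator computed from the first `N` samples of the linear model
`Y_i = X_iᵀ θ + ε_i`. -/
def thetaHat [NeZero M] {N : ℕ} (X : ℕ → Ω → Vec p) (ε : ℕ → Ω → ℝ) (θ : Vec p)
    (B : Ω → Fin N → Fin M) (ϑ₀ : Ω → Vec p) (α : ℝ) (m : Fin M) (ω : Ω) : Vec p :=
  estimator α (fun i : Fin N => X i ω) (fun i : Fin N => ⟪X i ω, θ⟫ + ε i ω) (B ω) (ϑ₀ ω) m

/-- The conditional mean of the FMGD estimator given covariates and mini-batches: the mean of its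
regular conditional distribution. -/
def muHat [NeZero M] {N : ℕ} (P : Measure Ω) [IsFiniteMeasure P] (X : ℕ → Ω → Vec p)
    (ε : ℕ → Ω → ℝ) (θ : Vec p) (B : Ω → Fin N → Fin M) (ϑ₀ : Ω → Vec p) (α : ℝ) (m : Fin M)
    (ω : Ω) : Vec p :=
  ∫ u, u ∂(condDistrib (thetaHat X ε θ B ϑ₀ α m) (design X B) P (design X B ω))

/-- `√N V^(-1/2) (θ̂ - μ̂)`. -/
def standardized [NeZero M] {N : ℕ} (P : Measure Ω) [IsFiniteMeasure P] (X : ℕ → Ω → Vec p)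
    (ε : ℕ → Ω → ℝ) (θ : Vec p) (B : Ω → Fin N → Fin M) (ϑ₀ : Ω → Vec p) (α : ℝ) (m : Fin M)
    (V : Matrix (Fin p) (Fin p) ℝ) (ω : Ω) : Vec p :=
  √(N : ℝ) • Matrix.toEuclideanCLM (𝕜 := ℝ) (invSqrt V)
    (thetaHat X ε θ B ϑ₀ α m ω - muHat P X ε θ B ϑ₀ α m ω)

end Model

end FMGD

end

/-! The error `ϑ - θ` obeys an affine recursion: the update on mini-batch `k` multiplies it by `1 -
α • batchCov x b k` and adds `α` times the mean of `e i • x i` over the batch. If each of these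
operators has norm less than one (`Contracting`), one epoch is an affine contraction. The iterates
then converge for every initial value, and the limit is `θ + ∑ i, e i • coef α x b m i`
(`estimator_eq`), linear in the noise with coefficients that depend on the design alone. Since the
noise is independent of the design and centered, the conditional mean is exactly `θ` on this event
(`muHat_eq_of_contracting`).

Almost surely every mini-batch second moment matrix tends to `Σ_xx` (`ae_tendsto_batchCov`). As the
batches may be drawn anew for every `n`, this rests on summable fourth moments of the averages.
Hence designs are eventually contracting for each `α < 2 / λ₁`. Contraction at `a` implies
contraction at every smaller positive rate, so a single event of probability tending to one gives
the first claim uniformly.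

In the limit the operators of all batches become the same `1 - α Σ_xx`, so the ordered products
become powers and everything diagonalizes together. In an eigendirection with eigenvalue `s`, and
with `a = 1 - α s`, the variance is `s⁻¹ * M * ∑ a ^ (2 d) / (∑ a ^ d) ^ 2`, sums over `d < M`. The
second factor (`inflation`) is a Cauchy–Schwarz ratio. Its excess over one is of order `(1 - a) ^
2`, with leading constant `(M ^ 2 - 1) / 12`, the variance of the uniform distribution on `0, …, M -
1`.

For a fixed design the normal limit is a central limit theorem for weighted sums of the noise
(`tendsto_charFun_sum_smul`). The weights are negligible because `max ‖X i‖ = o(√n)`. Dominated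
convergence of characteristic functions passes from the conditional to the unconditional statement.
-/

noncomputable section

namespace FMGD

/-! ### Orbits of affine maps and contractions. -/

section Affine

variable {E : Type*} [NormedAddCommGroup E] [NormedSpace ℝ E]

/-- The ordered product `A (j + d - 1) * ⋯ * A (j + 1) * A j`. -/
def ordProd {R : Type*} [Monoid R] (A : ℕ → R) (j : ℕ) : ℕ → R
  | 0 => 1
  | d + 1 => A (j + d) * ordProd A j d

lemma tendsto_ordProd {ι R : Type*} [NormedRing R] {l : Filter ι} {A : ι → ℕ → R} {a : R}
    (h : ∀ j, Tendsto (fun n => A n j) l (𝓝 a)) (j d : ℕ) :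
    Tendsto (fun n => ordProd (A n) j d) l (𝓝 (a ^ d)) := by
  induction d with
  | zero => simpa [ordProd] using tendsto_const_nhds
  | succ d ih =>
    simp only [ordProd, pow_succ']
    exact (h _).mul ih

/-- Variation of constants: `g j` enters with step `j`, so only the `k - 1 - j` later operators act
on it. -/
lemma affine_orbit_eq (A : ℕ → E →L[ℝ] E) (g e : ℕ → E)
    (he : ∀ k, e (k + 1) = A k (e k) + g k) (k : ℕ) :
    e k = ordProd A 0 k (e 0) +
      ∑ j ∈ Finset.range k, ordProd A (j + 1) (k - 1 - j) (g j) := by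
  induction k with
  | zero => simp [ordProd]
  | succ k ih =>
    rw [he, ih, Finset.sum_range_succ, map_add, map_sum]
    have h1 : ∀ j ∈ Finset.range k, A k (ordProd A (j + 1) (k - 1 - j) (g j)) =
        ordProd A (j + 1) (k + 1 - 1 - j) (g j) := by
      intro j hj
      have hj := Finset.mem_range.1 hj
      have : k + 1 - 1 - j = (k - 1 - j) + 1 := by omega
      rw [this, ordProd]
      have : j + 1 + (k - 1 - j) = k := by omega
      rw [this]; rfl
    rw [Finset.sum_congr rfl h1]
    simp [ordProd, add_assoc]

lemma norm_ordProd_le_one {A : ℕ → E →L[ℝ] E} (h : ∀ j, ‖A j‖ < 1) (j d : ℕ) :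
    ‖ordProd A j d‖ ≤ 1 := by
  induction d with
  | zero => exact ContinuousLinearMap.norm_id_le
  | succ d ih =>
    exact (norm_mul_le _ _).trans (mul_le_one₀ (h _).le (norm_nonneg _) ih)

lemma norm_ordProd_lt_one {A : ℕ → E →L[ℝ] E} (h : ∀ j, ‖A j‖ < 1) (j : ℕ) {d : ℕ}
    (hd : d ≠ 0) : ‖ordProd A j d‖ < 1 := by
  obtain ⟨d, rfl⟩ := Nat.exists_eq_succ_of_ne_zero hd
  calc ‖ordProd A j (d + 1)‖ ≤ ‖A (j + d)‖ * ‖ordProd A j d‖ := norm_mul_le _ _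
    _ ≤ ‖A (j + d)‖ * 1 := by
      gcongr
      exact norm_ordProd_le_one h j d
    _ < 1 := by simpa using h _

lemma inverse_one_sub_apply [CompleteSpace E] {T : E →L[ℝ] E} (hT : ‖T‖ < 1) (g : E) :
    Ring.inverse (1 - T) g = T (Ring.inverse (1 - T) g) + g := by
  have h : (1 - T) * Ring.inverse (1 - T) = 1 :=
    Ring.mul_inverse_cancel _ (isUnit_one_sub_of_norm_lt_one hT)
  have h2 := congrArg (fun S : E →L[ℝ] E => S g) h
  change Ring.inverse (1 - T) g - T (Ring.inverse (1 - T) g) = g at h2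
  rwa [sub_eq_iff_eq_add, add_comm] at h2

/-- The distance to the fixed point shrinks geometrically. The limit does not involve `e 0`, which
is why initial values can be arbitrary. -/
lemma tendsto_affine_orbit [CompleteSpace E] {T : E →L[ℝ] E} (hT : ‖T‖ < 1) (g : E) (e : ℕ → E)
    (he : ∀ t, e (t + 1) = T (e t) + g) : Tendsto e atTop (𝓝 (Ring.inverse (1 - T) g)) := by
  set f := Ring.inverse (1 - T) g with hf
  have hb : ∀ t, ‖e t - f‖ ≤ ‖T‖ ^ t * ‖e 0 - f‖ := by
    intro t
    induction t with
    | zero => simp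
    | succ t ih =>
      have : e (t + 1) - f = T (e t - f) := by
        rw [he, map_sub]
        nth_rewrite 1 [hf]
        rw [inverse_one_sub_apply hT g]
        abel
      rw [this, pow_succ', mul_assoc]
      exact (T.le_opNorm _).trans (by gcongr)
  rw [tendsto_iff_norm_sub_tendsto_zero]
  refine squeeze_zero (fun _ => norm_nonneg _) hb ?_
  simpa using (tendsto_pow_atTop_nhds_zero_of_lt_one (norm_nonneg _) hT).mul_const ‖e 0 - f‖

end Affine

/-! ### The estimator as a linear form in the noise. -/

section Batches

variable {p N M : ℕ}

/-- The second moment matrix of the covariates in the mini-batch `k`, as an operator. -/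
def batchCov (x : Fin N → Vec p) (b : Fin N → Fin M) (k : Fin M) : Vec p →L[ℝ] Vec p :=
  ((Finset.univ.filter fun i => b i = k).card : ℝ)⁻¹ •
    ∑ i ∈ Finset.univ.filter fun i => b i = k, (innerSL ℝ (x i)).smulRight (x i)

lemma batchCov_apply (x : Fin N → Vec p) (b : Fin N → Fin M) (k : Fin M) (u : Vec p) :
    batchCov x b k u = ((Finset.univ.filter fun i => b i = k).card : ℝ)⁻¹ •
      ∑ i ∈ Finset.univ.filter fun i => b i = k, ⟪x i, u⟫ • x i := by
  simp [batchCov]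

lemma inner_batchCov (x : Fin N → Vec p) (b : Fin N → Fin M) (k : Fin M) (u : Vec p) :
    ⟪u, batchCov x b k u⟫ = ((Finset.univ.filter fun i => b i = k).card : ℝ)⁻¹ *
      ∑ i ∈ Finset.univ.filter fun i => b i = k, ⟪u, x i⟫ ^ 2 := by
  rw [batchCov_apply, inner_smul_right, inner_sum]
  congr 1
  refine Finset.sum_congr rfl fun i _ => ?_
  rw [inner_smul_right, real_inner_comm, sq]

/-- The mean of `e i • x i` over the mini-batch `k`. -/
def batchNoise (x : Fin N → Vec p) (e : Fin N → ℝ) (b : Fin N → Fin M) (k : Fin M) : Vec p :=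
  ((Finset.univ.filter fun i => b i = k).card : ℝ)⁻¹ •
    ∑ i ∈ Finset.univ.filter fun i => b i = k, e i • x i

lemma batchGrad_linear_model (x : Fin N → Vec p) (e : Fin N → ℝ) (θ : Vec p) (b : Fin N → Fin M)
    (k : Fin M) (ϑ : Vec p) :
    batchGrad x (fun i => ⟪x i, θ⟫ + e i) b k ϑ =
      batchCov x b k (ϑ - θ) - batchNoise x e b k := by
  rw [batchCov_apply, batchNoise, batchGrad, ← smul_sub, ← Finset.sum_sub_distrib]
  congr 1
  refine Finset.sum_congr rfl fun i _ => ?_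
  rw [← sub_smul, inner_sub_right]
  congr 1; ring

/-- A design for which every single update is a contraction. -/
def Contracting (α : ℝ) (x : Fin N → Vec p) (b : Fin N → Fin M) : Prop :=
  ∀ k, ‖(1 : Vec p →L[ℝ] Vec p) - α • batchCov x b k‖ < 1

/-- The update operator at rate `α` is a convex combination of the identity and the operator at rate
`a`, with positive weight on the latter. Thus one event serves all rates in `(0, a]`. -/
lemma Contracting.mono {α a : ℝ} {x : Fin N → Vec p} {b : Fin N → Fin M}
    (h : Contracting a x b) (hα : 0 < α) (hαa : α ≤ a) : Contracting α x b := by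
  intro k
  have ha : 0 < a := hα.trans_le hαa
  have hr : α / a ≤ 1 := (div_le_one ha).2 hαa
  have hr0 : 0 < α / a := by positivity
  have : (1 : Vec p →L[ℝ] Vec p) - α • batchCov x b k =
      (1 - α / a) • (1 : Vec p →L[ℝ] Vec p) + (α / a) • (1 - a • batchCov x b k) := by
    rw [smul_sub, smul_smul, div_mul_cancel₀ _ ha.ne']
    module
  rw [this]
  calc _ ≤ ‖(1 - α / a) • (1 : Vec p →L[ℝ] Vec p)‖ +
        ‖(α / a) • ((1 : Vec p →L[ℝ] Vec p) - a • batchCov x b k)‖ := norm_add_le _ _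
    _ ≤ (1 - α / a) * 1 + (α / a) * ‖(1 : Vec p →L[ℝ] Vec p) - a • batchCov x b k‖ := by
      rw [norm_smul, norm_smul, Real.norm_of_nonneg (sub_nonneg.2 hr), Real.norm_of_nonneg hr0.le]
      gcongr
      exact ContinuousLinearMap.norm_id_le
    _ < (1 - α / a) * 1 + (α / a) * 1 := by gcongr; exact h k
    _ = 1 := by ring

variable [NeZero M]

/-- The linear part of the update on the mini-batch that comes `j` updates after the one that
follows the mini-batch `m`. -/
def stepOp (α : ℝ) (x : Fin N → Vec p) (b : Fin N → Fin M) (m : Fin M) (j : ℕ) :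
    Vec p →L[ℝ] Vec p :=
  1 - α • batchCov x b (Fin.ofNat M (m + 1 + j))

/-- The coefficient of the noise variable `e i` in the limit of the iterates of mini-batch `m`. -/
def coef (α : ℝ) (x : Fin N → Vec p) (b : Fin N → Fin M) (m : Fin M) (i : Fin N) : Vec p :=
  (α * ((Finset.univ.filter fun i' => b i' = b i).card : ℝ)⁻¹) •
    Ring.inverse (1 - ordProd (stepOp α x b m) 0 M)
      -- Subtraction in `Fin M` is cyclic: `b i - (m + 1)` is the position of the batch of `i` in an
      -- epoch that starts after `m` and ends with `m`. The operators at the later positions act on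
      -- its noise.
      (ordProd (stepOp α x b m) (((b i - (m + 1) : Fin M) : ℕ) + 1)
        (M - 1 - ((b i - (m + 1) : Fin M) : ℕ)) (x i))

lemma ofNat_add_val (m j : Fin M) : Fin.ofNat M ((m : ℕ) + 1 + (j : ℕ)) = j + (m + 1) := by
  ext
  simp only [Fin.val_ofNat, Fin.val_add, Fin.val_one']
  rw [Nat.add_comm (j : ℕ)]
  simp [Nat.add_mod]

/-- From one visit of mini-batch `m` to the next there are `M` updates, and their labels are
periodic, so the affine map is the same for every `t`. -/
lemma epochIter_succ (α : ℝ) (x : Fin N → Vec p) (e : Fin N → ℝ) (θ : Vec p)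
    (b : Fin N → Fin M) (ϑ₀ : Vec p) (m : Fin M) (t : ℕ) :
    epochIter α x (fun i => ⟪x i, θ⟫ + e i) b ϑ₀ m (t + 1) - θ =
      ordProd (stepOp α x b m) 0 M (epochIter α x (fun i => ⟪x i, θ⟫ + e i) b ϑ₀ m t - θ) +
      ∑ j ∈ Finset.range M, ordProd (stepOp α x b m) (j + 1) (M - 1 - j)
        (α • batchNoise x e b (Fin.ofNat M (m + 1 + j))) := by
  have h := affine_orbit_eq (stepOp α x b m)
    (fun j => α • batchNoise x e b (Fin.ofNat M (m + 1 + j)))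
    (fun j => iter α x (fun i => ⟪x i, θ⟫ + e i) b ϑ₀ (t * M + m + 1 + j) - θ) ?_ M
  · rw [add_zero] at h
    unfold epochIter
    have h2 : (t + 1) * M + (m : ℕ) + 1 = t * M + m + 1 + M := by ring
    rw [h2]; exact h
  · intro j
    have h3 : Fin.ofNat M (t * M + m + 1 + j) = Fin.ofNat M (m + 1 + j) := by
      ext
      simp only [Fin.val_ofNat]
      rw [show t * M + (m : ℕ) + 1 + j = m + 1 + j + t * M by ring, Nat.add_mul_mod_self_right]
    show iter α x _ b ϑ₀ (t * M + m + 1 + j + 1) - θ = _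
    rw [iter, batchGrad_linear_model, h3, stepOp]
    simp only [sub_apply, one_apply_eq_self, smul_apply, smul_sub]
    abel

/-- This is the fixed point of the epoch map, with the noise regrouped by mini-batch; `j ↦ j + (m +
1)` turns positions into labels. -/
lemma sum_coef (α : ℝ) (x : Fin N → Vec p) (e : Fin N → ℝ) (b : Fin N → Fin M) (m : Fin M) :
    ∑ i, e i • coef α x b m i = Ring.inverse (1 - ordProd (stepOp α x b m) 0 M)
      (∑ j ∈ Finset.range M, ordProd (stepOp α x b m) (j + 1) (M - 1 - j)
        (α • batchNoise x e b (Fin.ofNat M (m + 1 + j)))) := by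
  rw [Finset.sum_range, ← Finset.sum_fiberwise (s := Finset.univ) (g := b), map_sum,
    ← Equiv.sum_comp (Equiv.addRight (m + 1)) (g := fun k => ∑ i with b i = k, e i • coef α x b m i)]
  refine Finset.sum_congr rfl fun j _ => ?_
  rw [ofNat_add_val, Equiv.coe_addRight, batchNoise]
  simp only [map_smul, map_sum, Finset.smul_sum]
  refine Finset.sum_congr rfl fun i hi => ?_
  have hi : b i = j + (m + 1) := (Finset.mem_filter.1 hi).2
  rw [coef, hi, add_sub_cancel_right]
  simp only [smul_smul]
  congr 1; ring

lemma estimator_eq (α : ℝ) (x : Fin N → Vec p) (e : Fin N → ℝ) (θ : Vec p)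
    (b : Fin N → Fin M) (ϑ₀ : Vec p) (m : Fin M) (h : Contracting α x b) :
    estimator α x (fun i => ⟪x i, θ⟫ + e i) b ϑ₀ m = θ + ∑ i, e i • coef α x b m i := by
  have hT : ‖ordProd (stepOp α x b m) 0 M‖ < 1 :=
    norm_ordProd_lt_one (fun j => h _) 0 (NeZero.ne M)
  have h1 := (tendsto_affine_orbit hT _ (fun t => epochIter α x _ b ϑ₀ m t - θ)
    (epochIter_succ α x e θ b ϑ₀ m)).const_add θ
  rw [← sum_coef] at h1
  simp only [add_sub_cancel] at h1
  have h2 : ∃ l : Vec p, Tendsto (epochIter α x (fun i => ⟪x i, θ⟫ + e i) b ϑ₀ m) atTop (𝓝 l) :=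
    ⟨_, h1⟩
  rw [estimator, dif_pos h2]
  exact tendsto_nhds_unique h2.choose_spec h1

end Batches

end FMGD

/-! ### Almost sure convergence, independence and conditional distributions. -/

lemma ae_tendsto_zero_of_tsum_lintegral_ne_top {Ω : Type*}
    [MeasurableSpace Ω] {P : Measure Ω} {W : ℕ → Ω → ENNReal}
    (hW : ∀ n, Measurable (W n)) (h : ∑' n, ∫⁻ ω, W n ω ∂P ≠ ⊤) :
    ∀ᵐ ω ∂P, Tendsto (fun n => W n ω) atTop (𝓝 0) := by
  -- By Tonelli the series has finite expectation, so it converges almost surely and its terms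
  -- vanish.
  rw [← lintegral_tsum fun n => (hW n).aemeasurable] at h
  filter_upwards [ae_lt_top (Measurable.tsum hW) h] with ω hω
  exact ENNReal.tendsto_atTop_zero_of_tsum_ne_top hω.ne

section Independence

variable {Ω : Type*} [MeasurableSpace Ω] {P : Measure Ω} [IsProbabilityMeasure P]

/-- If `Z = f (D, e)` on the event `D ∈ G` and `e` is independent of `D`, then on this event the
conditional distribution of `Z` given `D = d` is the distribution of `f (d, e)`. -/
lemma condDistrib_ae_eq_map_of_indepFun {δ ξ F : Type*} [MeasurableSpace δ] [MeasurableSpace ξ]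
    [MeasurableSpace F] [StandardBorelSpace F] [Nonempty F] {D : Ω → δ} {e : Ω → ξ}
    {Z : Ω → F} {f : δ × ξ → F} {G : Set δ} (hD : Measurable D) (he : Measurable e)
    (hZ : Measurable Z) (hf : Measurable f) (hG : MeasurableSet G) (hind : IndepFun D e P)
    (h : ∀ᵐ ω ∂P, D ω ∈ G → Z ω = f (D ω, e ω)) :
    ∀ᵐ ω ∂P, D ω ∈ G → condDistrib Z D P (D ω) = P.map (fun ω' => f (D ω, e ω')) := by
  have : IsProbabilityMeasure (P.map e) := Measure.isProbabilityMeasure_map he.aemeasurable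
  have : IsProbabilityMeasure (P.map D) := Measure.isProbabilityMeasure_map hD.aemeasurable
  let κ : Kernel δ F := (Kernel.id ×ₖ Kernel.const δ (P.map e)).map f
  have hκ : ∀ d, κ d = P.map (fun ω' => f (d, e ω')) := by
    intro d
    rw [Kernel.map_apply _ hf, Kernel.prod_apply, Kernel.id_apply, Kernel.const_apply,
      Measure.dirac_prod, Measure.map_map hf (by fun_prop), Measure.map_map (by fun_prop) he]
    rfl
  -- Since `f` describes `Z` only on `G`, the kernels are compared through their joint laws with the
  -- law of `D` restricted to `G`; this determines them almost everywhere there.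
  have key : condDistrib Z D P =ᵐ[(P.map D).restrict G] κ := by
    refine Kernel.ae_eq_of_compProd_eq ?_
    ext s hs
    have h1 : ∀ η : Kernel δ F, IsMarkovKernel η →
        ((P.map D).restrict G ⊗ₘ η) s = ((P.map D) ⊗ₘ η) (s ∩ Prod.fst ⁻¹' G) := by
      intro η _
      rw [Measure.compProd_apply hs, Measure.compProd_apply (hs.inter (measurable_fst hG)),
        ← lintegral_indicator hG]
      refine lintegral_congr fun d => ?_
      by_cases hd : d ∈ G
      · rw [Set.indicator_of_mem hd]
        congr 1; ext y; simp [hd]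
      · rw [Set.indicator_of_notMem hd]
        have : Prod.mk d ⁻¹' (s ∩ Prod.fst ⁻¹' G) = (∅ : Set F) := by ext y; simp [hd]
        rw [this, measure_empty]
    have hκM : IsMarkovKernel κ := Kernel.IsMarkovKernel.map _ hf
    rw [h1 _ inferInstance, h1 _ hκM, compProd_map_condDistrib hZ.aemeasurable]
    have h2 : (P.map D) ⊗ₘ κ = P.map (fun ω => (D ω, f (D ω, e ω))) := by
      have h3 := (indepFun_iff_map_prod_eq_prod_map_map hD.aemeasurable he.aemeasurable).1 hind
      have h4 : P.map (fun ω => (D ω, f (D ω, e ω))) =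
          (P.map (fun ω => (D ω, e ω))).map (fun q => (q.1, f q)) := by
        rw [Measure.map_map (by fun_prop) (by fun_prop)]; rfl
      rw [h4, h3]
      ext u hu
      rw [Measure.compProd_apply hu, Measure.map_apply (by fun_prop) hu,
        Measure.prod_apply ((measurable_fst.prodMk hf) hu)]
      refine lintegral_congr fun d => ?_
      rw [hκ, Measure.map_apply (by fun_prop) (measurable_prodMk_left hu),
        Measure.map_apply he (measurable_prodMk_left ((measurable_fst.prodMk hf) hu))]
      rfl
    have hs' := hs.inter (measurable_fst (α := δ) (β := F) hG)
    rw [h2, Measure.map_apply (by fun_prop) hs', Measure.map_apply (by fun_prop) hs']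
    refine measure_congr ?_
    filter_upwards [h] with ω hω
    refine propext ⟨fun h5 => ?_, fun h5 => ?_⟩
    · have h6 := hω h5.2
      change (D ω, f (D ω, e ω)) ∈ _
      rw [← h6]; exact h5
    · have h6 := hω h5.2
      change (D ω, Z ω) ∈ _
      rw [h6]; exact h5
  rw [Filter.EventuallyEq, ae_restrict_iff' hG] at key
  filter_upwards [ae_of_ae_map hD.aemeasurable key] with ω hω hG'
  rw [hω hG', hκ]

/-- The law of the family of pairs is a power of one product measure, and rearranging coordinates
splits it into two powers. -/
lemma indepFun_pi_of_iIndepFun_prodMk {ι β γ : Type*} [Fintype ι] [MeasurableSpace β]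
    [MeasurableSpace γ] {X : ι → Ω → β} {Y : ι → Ω → γ} (hX : ∀ i, Measurable (X i))
    (hY : ∀ i, Measurable (Y i)) (h : iIndepFun (fun i ω => (X i ω, Y i ω)) P)
    (hident : ∀ i j, P.map (fun ω => (X i ω, Y i ω)) = P.map (fun ω => (X j ω, Y j ω)))
    (hXY : ∀ i, IndepFun (X i) (Y i) P) :
    IndepFun (fun ω i => X i ω) (fun ω i => Y i ω) P := by
  have hXm : Measurable fun ω i => X i ω := measurable_pi_lambda _ hX
  have hYm : Measurable fun ω i => Y i ω := measurable_pi_lambda _ hY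
  rcases isEmpty_or_nonempty ι with hι | ⟨⟨i₀⟩⟩
  · have : (fun ω i => X i ω) = fun (_ : Ω) (i : ι) => (isEmptyElim i : β) := by
      funext ω i; exact isEmptyElim i
    rw [this]
    exact indepFun_const_left _ _
  rw [indepFun_iff_map_prod_eq_prod_map_map hXm.aemeasurable hYm.aemeasurable]
  have h1 := (iIndepFun_iff_map_fun_eq_pi_map (fun i => ((hX i).prodMk (hY i)).aemeasurable)).1 h
  have h2 := (iIndepFun_iff_map_fun_eq_pi_map (fun i => (hX i).aemeasurable)).1
    (h.comp (fun _ => Prod.fst) (fun _ => measurable_fst))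
  have h3 := (iIndepFun_iff_map_fun_eq_pi_map (fun i => (hY i).aemeasurable)).1
    (h.comp (fun _ => Prod.snd) (fun _ => measurable_snd))
  have hpX : ∀ i, P.map (X i) = P.map (X i₀) := by
    intro i
    have := congrArg (Measure.map Prod.fst) (hident i i₀)
    rwa [Measure.map_map (by fun_prop) ((hX _).prodMk (hY _)),
      Measure.map_map (by fun_prop) ((hX _).prodMk (hY _))] at this
  have hpY : ∀ i, P.map (Y i) = P.map (Y i₀) := by
    intro i
    have := congrArg (Measure.map Prod.snd) (hident i i₀)
    rwa [Measure.map_map (by fun_prop) ((hX _).prodMk (hY _)),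
      Measure.map_map (by fun_prop) ((hX _).prodMk (hY _))] at this
  have hp : ∀ i, P.map (fun ω => (X i ω, Y i ω)) = (P.map (X i₀)).prod (P.map (Y i₀)) := by
    intro i
    rw [(indepFun_iff_map_prod_eq_prod_map_map (hX i).aemeasurable (hY i).aemeasurable).1 (hXY i),
      hpX, hpY]
  have : IsProbabilityMeasure (P.map (X i₀)) :=
    Measure.isProbabilityMeasure_map (hX i₀).aemeasurable
  have : IsProbabilityMeasure (P.map (Y i₀)) :=
    Measure.isProbabilityMeasure_map (hY i₀).aemeasurable
  simp only [hp, hpX, hpY] at h1 h2 h3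
  have h4 := (measurePreserving_arrowProdEquivProdArrow β γ ι (fun _ => P.map (X i₀))
    (fun _ => P.map (Y i₀))).map_eq
  erw [h2, h3, ← h4, ← h1, Measure.map_map (MeasurableEquiv.measurable _)
    (measurable_pi_lambda _ fun i => (hX i).prodMk (hY i))]
  rfl

/-- The assumptions make the joint law of the three variables a triple product, which can be
bracketed in any way. -/
lemma indepFun_prodMk_of_indepFun_prodMk {β γ δ : Type*} [MeasurableSpace β]
    [MeasurableSpace γ] [MeasurableSpace δ] {B : Ω → β} {X : Ω → γ} {e : Ω → δ}
    (hB : Measurable B) (hX : Measurable X) (he : Measurable e)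
    (h1 : IndepFun B (fun ω => (X ω, e ω)) P) (h2 : IndepFun X e P) :
    IndepFun (fun ω => (X ω, B ω)) e P := by
  have h3 : IndepFun B X P := h1.comp measurable_id measurable_fst
  have : IsProbabilityMeasure (P.map B) := Measure.isProbabilityMeasure_map hB.aemeasurable
  have : IsProbabilityMeasure (P.map X) := Measure.isProbabilityMeasure_map hX.aemeasurable
  have : IsProbabilityMeasure (P.map e) := Measure.isProbabilityMeasure_map he.aemeasurable
  rw [indepFun_iff_map_prod_eq_prod_map_map hB.aemeasurable (hX.prodMk he).aemeasurable,
    (indepFun_iff_map_prod_eq_prod_map_map hX.aemeasurable he.aemeasurable).1 h2] at h1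
  rw [indepFun_iff_map_prod_eq_prod_map_map (hX.prodMk hB).aemeasurable he.aemeasurable,
    (indepFun_iff_map_prod_eq_prod_map_map hX.aemeasurable hB.aemeasurable).1 h3.symm]
  have h4 : P.map (fun ω => ((X ω, B ω), e ω)) =
      (P.map (fun ω => (B ω, (X ω, e ω)))).map (fun q => ((q.2.1, q.1), q.2.2)) := by
    rw [Measure.map_map (by fun_prop) (by fun_prop)]; rfl
  have h5 : ((P.map X).prod (P.map B)).prod (P.map e) =
      (((P.map B).prod (P.map X)).prod (P.map e)).map (Prod.map Prod.swap id) := by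
    rw [← Measure.map_prod_map _ _ (by fun_prop) (by fun_prop), Measure.prod_swap, Measure.map_id]
  rw [h4, h1, ← Measure.prodAssoc_prod, Measure.map_map (by fun_prop) (by fun_prop), h5]
  rfl

/-- By Fubini, random labels can be frozen: a bound that is uniform over the frozen value survives
averaging. -/
lemma lintegral_comp_le_of_indepFun {β γ : Type*} [MeasurableSpace β]
    [MeasurableSpace γ] {B : Ω → β} {D : Ω → γ} {F : β × γ → ENNReal}
    (hB : Measurable B) (hD : Measurable D) (hF : Measurable F) (h : IndepFun B D P)
    {c : ENNReal} (hc : ∀ ω, ∫⁻ ω', F (B ω, D ω') ∂P ≤ c) :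
    ∫⁻ ω, F (B ω, D ω) ∂P ≤ c := by
  have : IsProbabilityMeasure (P.map D) := Measure.isProbabilityMeasure_map hD.aemeasurable
  rw [← lintegral_map (f := F) (g := fun ω => (B ω, D ω)) hF (by fun_prop),
    (indepFun_iff_map_prod_eq_prod_map_map hB.aemeasurable hD.aemeasurable).1 h,
    lintegral_prod _ hF.aemeasurable, lintegral_map hF.lintegral_prod_right' hB]
  calc _ ≤ ∫⁻ _, c ∂P := by
        refine lintegral_mono fun ω => ?_
        rw [lintegral_map (by fun_prop) hD]
        exact hc ω
    _ = c := by simp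

end Independence

/-! ### Moment bounds. -/

section Moments

variable {Ω : Type*} [MeasurableSpace Ω] {P : Measure Ω} [IsProbabilityMeasure P]

/-- The layer cake formula bounds the moment by a convergent integral of `t ^ (q - 1) * exp (-t ^ 2
/ K ^ 2)`. -/
lemma memLp_of_gaussian_tail {X : Ω → ℝ} (hX : Measurable X) {K : ℝ} (hK : 0 < K)
    (h : ∀ u : ℝ, 0 < u → P.real {ω | u < |X ω|} ≤ Real.exp (1 - u ^ 2 / K ^ 2))
    {q : ℕ} (hq : q ≠ 0) : MemLp X q P := by
  have hq0 : (0 : ℝ) < q := by positivity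
  have h1 := lintegral_rpow_eq_lintegral_meas_lt_mul P (f := fun ω => |X ω|)
    (ae_of_all _ fun _ => abs_nonneg _) (by fun_prop) hq0
  have hint := (integrableOn_rpow_mul_exp_neg_mul_sq (b := 1 / K ^ 2) (by positivity)
    (s := (q : ℝ) - 1) (by linarith)).const_mul (Real.exp 1)
  have h2 : ∫⁻ t in Set.Ioi (0 : ℝ), P {ω | t < |X ω|} * ENNReal.ofReal (t ^ ((q : ℝ) - 1)) ≤
      ∫⁻ t in Set.Ioi (0 : ℝ), ENNReal.ofReal
        (Real.exp 1 * (t ^ ((q : ℝ) - 1) * Real.exp (-(1 / K ^ 2) * t ^ 2))) := by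
    refine setLIntegral_mono' measurableSet_Ioi fun t ht => ?_
    have ht : 0 < t := ht
    have h3 : P {ω | t < |X ω|} ≤ ENNReal.ofReal (Real.exp (1 - t ^ 2 / K ^ 2)) := by
      rw [← ofReal_measureReal]
      exact ENNReal.ofReal_le_ofReal (h t ht)
    calc _ ≤ ENNReal.ofReal (Real.exp (1 - t ^ 2 / K ^ 2)) *
          ENNReal.ofReal (t ^ ((q : ℝ) - 1)) := by gcongr
      _ = _ := by
        rw [← ENNReal.ofReal_mul (Real.exp_nonneg _)]
        congr 1
        rw [show 1 - t ^ 2 / K ^ 2 = 1 + -(1 / K ^ 2) * t ^ 2 by ring, Real.exp_add]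
        ring
  rw [← integrable_norm_rpow_iff hX.aestronglyMeasurable (by positivity) (by simp)]
  refine ⟨by simpa using (by fun_prop : Measurable fun ω => |X ω| ^ q).aestronglyMeasurable, ?_⟩
  rw [hasFiniteIntegral_iff_ofReal (ae_of_all _ fun _ => by positivity)]
  simp only [ENNReal.toReal_natCast, Real.norm_eq_abs]
  rw [h1]
  refine ENNReal.mul_lt_top ENNReal.ofReal_lt_top (h2.trans_lt ?_)
  rw [← hasFiniteIntegral_iff_ofReal]
  · exact hint.2
  · filter_upwards [ae_restrict_mem measurableSet_Ioi] with t ht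
    have ht : 0 < t := ht
    change 0 ≤ _
    positivity

lemma integrable_pow_mul_pow {X Y : Ω → ℝ} {r : ℕ} (hX : MemLp X r P) (hY : MemLp Y r P)
    {a b : ℕ} (hab : a + b ≤ r) : Integrable (fun ω => X ω ^ a * Y ω ^ b) P := by
  have h1 : MemLp (fun ω => |X ω| + |Y ω|) r P := hX.norm.add hY.norm
  have h2 : Integrable (fun ω => (|X ω| + |Y ω|) ^ (a + b)) P := by
    have := (h1.mono_exponent (p := ((a + b : ℕ) : ENNReal)) (by exact_mod_cast hab)).integrable_norm_pow'
    refine this.congr (ae_of_all _ fun ω => ?_)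
    simp only [Real.norm_eq_abs, abs_of_nonneg (add_nonneg (abs_nonneg (X ω)) (abs_nonneg (Y ω)))]
  refine h2.mono' ((hX.1.pow a).mul (hY.1.pow b)) (ae_of_all _ fun ω => ?_)
  rw [norm_mul, norm_pow, norm_pow, Real.norm_eq_abs, Real.norm_eq_abs, pow_add]
  gcongr <;> simp

/-- Adding one independent centered term, every cross term with a first power has mean zero; of the
mixed terms only `6 * S ^ 2 * Z ^ 2` remains. The bound is quadratic in the number of terms, which
makes fourth moments of averages summable. -/
lemma integral_sum_pow_four_le {ι : Type*} {Z : ι → Ω → ℝ} (hind : iIndepFun Z P)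
    (hZ : ∀ i, Measurable (Z i)) (h4 : ∀ i, MemLp (Z i) 4 P) (h0 : ∀ i, ∫ ω, Z i ω ∂P = 0)
    {A C : ℝ} (hA : ∀ i, ∫ ω, Z i ω ^ 2 ∂P ≤ A) (hC : ∀ i, ∫ ω, Z i ω ^ 4 ∂P ≤ C)
    (s : Finset ι) :
    ∫ ω, (∑ i ∈ s, Z i ω) ^ 2 ∂P ≤ s.card * A ∧
    ∫ ω, (∑ i ∈ s, Z i ω) ^ 4 ∂P ≤ s.card * C + 3 * (s.card * A) ^ 2 := by
  classical
  induction s using Finset.induction_on with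
  | empty => simp
  | insert i s hi ih =>
    obtain ⟨ih2, ih4⟩ := ih
    have hA0 : 0 ≤ A := (integral_nonneg fun _ => by positivity).trans (hA i)
    set S : Ω → ℝ := fun ω => ∑ j ∈ s, Z j ω with hS
    have hSm : Measurable S := Finset.measurable_sum _ fun j _ => hZ j
    have hS4 : MemLp S (4 : ℕ) P := memLp_finsetSum _ fun j _ => by exact_mod_cast h4 j
    have hZ4 : MemLp (Z i) (4 : ℕ) P := by exact_mod_cast h4 i
    have hSZ : IndepFun S (Z i) P := by
      have := hind.indepFun_finsetSum_of_notMem hZ hi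
      convert this using 1
      funext ω; simp [hS]
    have hint : ∀ a b : ℕ, a + b ≤ 4 → Integrable (fun ω => S ω ^ a * Z i ω ^ b) P :=
      fun a b hab => integrable_pow_mul_pow hS4 hZ4 hab
    have hprod : ∀ a b : ℕ, ∫ ω, S ω ^ a * Z i ω ^ b ∂P =
        (∫ ω, S ω ^ a ∂P) * ∫ ω, Z i ω ^ b ∂P := fun a b =>
      (hSZ.comp (φ := fun x => x ^ a) (ψ := fun x => x ^ b) (by fun_prop)
        (by fun_prop)).integral_fun_mul_eq_mul_integral (by fun_prop) (by fun_prop)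
    have hsum : ∀ ω, ∑ j ∈ insert i s, Z j ω = S ω + Z i ω := fun ω => by
      rw [Finset.sum_insert hi, add_comm]
    have e2 : ∫ ω, (S ω + Z i ω) ^ 2 ∂P = ∫ ω, S ω ^ 2 ∂P + ∫ ω, Z i ω ^ 2 ∂P := by
      have : ∀ ω, (S ω + Z i ω) ^ 2 =
          S ω ^ 2 * Z i ω ^ 0 + 2 * (S ω ^ 1 * Z i ω ^ 1) + S ω ^ 0 * Z i ω ^ 2 :=
        fun ω => by ring
      simp only [this]
      have i1 := hint 2 0 (by norm_num)
      have i2 := (hint 1 1 (by norm_num)).const_mul 2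
      rw [integral_add (i1.fun_add i2) (hint 0 2 (by norm_num)), integral_add i1 i2,
        integral_const_mul, hprod, hprod, hprod]
      simp [h0]
    have e4 : ∫ ω, (S ω + Z i ω) ^ 4 ∂P =
        ∫ ω, S ω ^ 4 ∂P + 6 * ((∫ ω, S ω ^ 2 ∂P) * ∫ ω, Z i ω ^ 2 ∂P) +
          4 * ((∫ ω, S ω ∂P) * ∫ ω, Z i ω ^ 3 ∂P) + ∫ ω, Z i ω ^ 4 ∂P := by
      have : ∀ ω, (S ω + Z i ω) ^ 4 =
          S ω ^ 4 * Z i ω ^ 0 + 4 * (S ω ^ 3 * Z i ω ^ 1) + 6 * (S ω ^ 2 * Z i ω ^ 2) +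
            4 * (S ω ^ 1 * Z i ω ^ 3) + S ω ^ 0 * Z i ω ^ 4 :=
        fun ω => by ring
      simp only [this]
      have i1 := hint 4 0 (by norm_num)
      have i2 := (hint 3 1 (by norm_num)).const_mul 4
      have i3 := (hint 2 2 (by norm_num)).const_mul 6
      have i4 := (hint 1 3 (by norm_num)).const_mul 4
      have i5 := hint 0 4 (by norm_num)
      rw [integral_add (((i1.fun_add i2).fun_add i3).fun_add i4) i5,
        integral_add ((i1.fun_add i2).fun_add i3) i4, integral_add (i1.fun_add i2) i3, integral_add i1 i2,
        integral_const_mul, integral_const_mul, integral_const_mul, hprod, hprod, hprod, hprod,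
        hprod]
      simp [h0]
    have eS : ∫ ω, S ω ∂P = 0 := by
      rw [integral_finsetSum _ fun j _ => (h4 j).integrable (by norm_num)]
      simp [h0]
    have hi2 := hA i
    have hi20 : 0 ≤ ∫ ω, Z i ω ^ 2 ∂P := integral_nonneg fun _ => by positivity
    simp only [hsum]
    rw [e2, e4, eS, Finset.card_insert_of_notMem hi]
    push_cast
    refine ⟨by linarith, ?_⟩
    have h5 : (∫ ω, S ω ^ 2 ∂P) * ∫ ω, Z i ω ^ 2 ∂P ≤ (s.card * A) * A := by gcongr
    have := hC i
    -- With `c = s.card`, the cross term `6 c A ^ 2` fits into `3 (c + 1) ^ 2 A ^ 2 - 3 c ^ 2 A ^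
    -- 2`.
    nlinarith [sq_nonneg A]

end Moments

/-! ### A central limit theorem for weighted sums. -/

section CentralLimit

open Asymptotics

lemma norm_prod_sub_prod_le {ι : Type*} (s : Finset ι) {f g : ι → ℂ} (hf : ∀ i, ‖f i‖ ≤ 1)
    (hg : ∀ i, ‖g i‖ ≤ 1) : ‖∏ i ∈ s, f i - ∏ i ∈ s, g i‖ ≤ ∑ i ∈ s, ‖f i - g i‖ := by
  classical
  induction s using Finset.induction_on with
  | empty => simp
  | insert i s hi ih =>
    rw [Finset.prod_insert hi, Finset.prod_insert hi, Finset.sum_insert hi]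
    have h1 : f i * ∏ j ∈ s, f j - g i * ∏ j ∈ s, g j =
        (f i - g i) * ∏ j ∈ s, f j + g i * (∏ j ∈ s, f j - ∏ j ∈ s, g j) := by ring
    rw [h1]
    refine (norm_add_le _ _).trans ?_
    rw [norm_mul, norm_mul]
    have h2 : ‖∏ j ∈ s, f j‖ ≤ 1 := by
      rw [norm_prod]
      exact Finset.prod_le_one (fun _ _ => norm_nonneg _) fun j _ => hf j
    refine add_le_add (mul_le_of_le_one_right (norm_nonneg _) h2) ?_
    exact (mul_le_of_le_one_left (norm_nonneg _) (hg i)).trans ih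

/-- Both functions have the Taylor polynomial `1 - σ ^ 2 t ^ 2 / 2`. Comparing with the exponential
rather than the polynomial keeps all factors in the unit disc, as `norm_prod_sub_prod_le` requires.
-/
lemma isLittleO_charFun_sub_exp {Ω : Type*} [MeasurableSpace Ω] {P : Measure Ω}
    [IsProbabilityMeasure P] {X : Ω → ℝ} (hX : MemLp X 2 P) (h0 : ∫ ω, X ω ∂P = 0) {σ : ℝ}
    (hσ : ∫ ω, X ω ^ 2 ∂P = σ ^ 2) :
    (fun t : ℝ => charFun (P.map X) t - Complex.exp (((-(σ ^ 2 / 2 * t ^ 2) : ℝ) : ℂ)))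
      =o[𝓝 0] fun t : ℝ => t ^ 2 := by
  have hXm : AEMeasurable X P := hX.1.aemeasurable
  have : IsProbabilityMeasure (P.map X) := Measure.isProbabilityMeasure_map hXm
  have hid : MemLp id 2 (P.map X) := (memLp_map_measure_iff (by fun_prop) hXm).2 hX
  have h1 : (fun t : ℝ => charFun (P.map X) t - (1 - ((σ ^ 2 : ℝ) : ℂ) * t ^ 2 / 2))
      =o[𝓝 0] fun t : ℝ => t ^ 2 := by
    have h2 := taylor_isLittleO_univ (x₀ := (0 : ℝ)) (n := 2) (contDiff_charFun hid)
    simp only [sub_zero] at h2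
    refine h2.congr_left fun t => ?_
    rw [taylorWithinEval_charFun_two_zero hXm hid, h0]
    have : ∫ ω, (X ^ 2) ω ∂P = σ ^ 2 := by simpa using hσ
    rw [this]
    simp
  have h3 : (fun t : ℝ => Complex.exp (((-(σ ^ 2 / 2 * t ^ 2) : ℝ) : ℂ)) -
      (1 - ((σ ^ 2 : ℝ) : ℂ) * t ^ 2 / 2)) =o[𝓝 0] fun t : ℝ => t ^ 2 := by
    have h4 := (Complex.hasDerivAt_exp 0).isLittleO
    have h5 : Tendsto (fun t : ℝ => (((-(σ ^ 2 / 2 * t ^ 2) : ℝ) : ℂ))) (𝓝 0) (𝓝 0) := by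
      have : Continuous fun t : ℝ => (((-(σ ^ 2 / 2 * t ^ 2) : ℝ) : ℂ)) := by fun_prop
      simpa using this.tendsto 0
    have h6 := h4.comp_tendsto h5
    refine (h6.congr_left fun t => ?_).trans_isBigO ?_
    · simp only [Function.comp, Complex.exp_zero, sub_zero, smul_eq_mul, mul_one]
      push_cast; ring
    · refine IsBigO.of_bound (σ ^ 2 / 2) (Eventually.of_forall fun t => ?_)
      simp only [Function.comp, sub_zero, Complex.norm_real, norm_neg, norm_mul]
      rw [Real.norm_of_nonneg (by positivity)]
  refine (h1.sub h3).congr_left fun t => ?_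
  ring

/-- Products of a function with the second order expansion of a centered characteristic function,
along an asymptotically negligible triangular array. -/
lemma tendsto_prod_of_isLittleO_sub_exp {φ : ℝ → ℂ} {κ : ℝ} (hκ : 0 ≤ κ)
    (hφ : ∀ s, ‖φ s‖ ≤ 1)
    (h : (fun t : ℝ => φ t - Complex.exp (((-(κ * t ^ 2) : ℝ) : ℂ))) =o[𝓝 0] fun t : ℝ => t ^ 2)
    {N : ℕ → ℕ} {a : ∀ n, Fin (N n) → ℝ} {v : ℝ}
    (hsum : Tendsto (fun n => ∑ i, a n i ^ 2) atTop (𝓝 v))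
    (hmax : ∀ η : ℝ, 0 < η → ∀ᶠ n in atTop, ∀ i, |a n i| ≤ η) :
    Tendsto (fun n => ∏ i, φ (a n i)) atTop (𝓝 (Complex.exp (((-(κ * v) : ℝ) : ℂ)))) := by
  have h1 : Tendsto (fun n => ∏ i, Complex.exp (((-(κ * a n i ^ 2) : ℝ) : ℂ))) atTop
      (𝓝 (Complex.exp (((-(κ * v) : ℝ) : ℂ)))) := by
    have h2 : ∀ n, ∏ i, Complex.exp (((-(κ * a n i ^ 2) : ℝ) : ℂ)) =
        Complex.exp (((-(κ * ∑ i, a n i ^ 2) : ℝ) : ℂ)) := by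
      intro n
      rw [← Complex.exp_sum, ← Complex.ofReal_sum, Finset.sum_neg_distrib, Finset.mul_sum]
    simp only [h2]
    have h3 : Continuous fun y : ℝ => Complex.exp (((-(κ * y) : ℝ) : ℂ)) := by fun_prop
    exact (h3.tendsto v).comp hsum
  have h4 : Tendsto (fun n => ∏ i, φ (a n i) -
      ∏ i, Complex.exp (((-(κ * a n i ^ 2) : ℝ) : ℂ))) atTop (𝓝 0) := by
    rw [Metric.tendsto_atTop']
    intro η hη
    have hv : 0 ≤ v := ge_of_tendsto' hsum fun n => Finset.sum_nonneg fun _ _ => sq_nonneg _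
    -- Eventually the sum of squares is below `v + 1`, so an error of `η / (v + 1) / 2` per unit of
    -- square adds up to at most `η / 2`.
    have hc : 0 < η / (v + 1) := by positivity
    obtain ⟨r, hr, hb⟩ := Metric.eventually_nhds_iff.1 (h.bound (half_pos hc))
    have hs : ∀ᶠ n in atTop, ∑ i, a n i ^ 2 < v + 1 :=
      hsum.eventually (gt_mem_nhds (by linarith))
    obtain ⟨n₀, hn₀⟩ := eventually_atTop.1 (hs.and (hmax (r / 2) (half_pos hr)))
    refine ⟨n₀, fun n hn => ?_⟩
    obtain ⟨hn1, hn2⟩ := hn₀ n hn.le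
    rw [dist_zero_right]
    have hexp : ∀ i, ‖Complex.exp (((-(κ * a n i ^ 2) : ℝ) : ℂ))‖ ≤ 1 := by
      intro i
      rw [Complex.norm_exp_ofReal, Real.exp_le_one_iff]
      have : 0 ≤ κ * a n i ^ 2 := by positivity
      linarith
    calc _ ≤ ∑ i, ‖φ (a n i) - Complex.exp (((-(κ * a n i ^ 2) : ℝ) : ℂ))‖ :=
          norm_prod_sub_prod_le _ (fun i => hφ _) hexp
      _ ≤ ∑ i, η / (v + 1) / 2 * a n i ^ 2 := by
        refine Finset.sum_le_sum fun i _ => ?_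
        have := hb (y := a n i) (by
          rw [dist_zero_right, Real.norm_eq_abs]
          linarith [hn2 i])
        simpa using this
      _ = η / (v + 1) / 2 * ∑ i, a n i ^ 2 := by rw [Finset.mul_sum]
      _ ≤ η / (v + 1) / 2 * (v + 1) := by gcongr
      _ = η / 2 := by field_simp
      _ < η := half_lt_self hη
  simpa using h4.add h1

/-- A central limit theorem for linear combinations of independent identically distributed
variables with asymptotically negligible vector coefficients, in terms of characteristic
functions. -/
lemma tendsto_charFun_sum_smul {Ω E : Type*} [MeasurableSpace Ω] {P : Measure Ω}
    [IsProbabilityMeasure P] [NormedAddCommGroup E] [InnerProductSpace ℝ E] [MeasurableSpace E]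
    [BorelSpace E] [SecondCountableTopology E] [CompleteSpace E] {ε : ℕ → Ω → ℝ}
    (hε : ∀ i, Measurable (ε i))
    (hind : iIndepFun ε P) (hident : ∀ i, P.map (ε i) = P.map (ε 0)) (hL2 : MemLp (ε 0) 2 P)
    (h0 : ∫ ω, ε 0 ω ∂P = 0) {σ : ℝ} (hσ : ∫ ω, ε 0 ω ^ 2 ∂P = σ ^ 2)
    {N : ℕ → ℕ} (c : ∀ n, Fin (N n) → E) {t : E} {v : ℝ}
    (hsum : Tendsto (fun n => ∑ i, ⟪c n i, t⟫ ^ 2) atTop (𝓝 v))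
    (hmax : ∀ η : ℝ, 0 < η → ∀ᶠ n in atTop, ∀ i, |⟪c n i, t⟫| ≤ η) :
    Tendsto (fun n => charFun (P.map fun ω => ∑ i : Fin (N n), ε i ω • c n i) t) atTop
      (𝓝 (Complex.exp (((-(σ ^ 2 / 2 * v) : ℝ) : ℂ)))) := by
  have h1 : ∀ n, charFun (P.map fun ω => ∑ i : Fin (N n), ε i ω • c n i) t =
      ∏ i, charFun (P.map (ε 0)) ⟪c n i, t⟫ := by
    intro n
    have h2 : iIndepFun (fun (i : Fin (N n)) ω => ε i ω • c n i) P :=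
      (hind.precomp (g := fun i : Fin (N n) => (i : ℕ)) Fin.val_injective).comp
        (fun i y => y • c n i) (fun i => by fun_prop)
    rw [iIndepFun.charFun_map_fun_sum_eq_prod (X := fun (i : Fin (N n)) ω => ε i ω • c n i)
      (fun i => ((hε i).smul_const _).aemeasurable) h2,
      Finset.prod_apply]
    refine Finset.prod_congr rfl fun i _ => ?_
    rw [← hident i, charFun_apply, charFun_apply,
      integral_map ((hε i).smul_const _).aemeasurable (by fun_prop),
      integral_map (hε i).aemeasurable (by fun_prop)]
    refine integral_congr_ae (ae_of_all _ fun ω => ?_)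
    simp only [inner_smul_left]
    congr 3
    simp [mul_comm]
  simp only [h1]
  have : IsProbabilityMeasure (P.map (ε 0)) := Measure.isProbabilityMeasure_map (hε 0).aemeasurable
  exact tendsto_prod_of_isLittleO_sub_exp (φ := charFun (P.map (ε 0))) (by positivity)
    (fun s => norm_charFun_le_one s)
    (isLittleO_charFun_sub_exp hL2 h0 hσ) hsum hmax

end CentralLimit

namespace FMGD

/-! ### Functions of a symmetric matrix. -/

section Spectral

open Unitary

variable {p : ℕ} {A : Matrix (Fin p) (Fin p) ℝ}

/-- The functions of the symmetric matrix `A`, given by their values at the eigenvalues. -/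
def spectralHom (hA : A.IsHermitian) : (Fin p → ℝ) →ₐ[ℝ] Matrix (Fin p) (Fin p) ℝ :=
  (conjStarAlgAut ℝ (Matrix (Fin p) (Fin p) ℝ)
    hA.eigenvectorUnitary).toAlgEquiv.toAlgHom.comp (Matrix.diagonalAlgHom ℝ)

lemma spectralHom_apply (hA : A.IsHermitian) (d : Fin p → ℝ) :
    spectralHom hA d = (hA.eigenvectorUnitary : Matrix (Fin p) (Fin p) ℝ) * Matrix.diagonal d *
      star (hA.eigenvectorUnitary : Matrix (Fin p) (Fin p) ℝ) := rfl

lemma spectralHom_eigenvalues (hA : A.IsHermitian) : spectralHom hA hA.eigenvalues = A := by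
  rw [spectralHom_apply]
  conv_rhs => rw [hA.spectral_theorem]
  rfl

lemma star_spectralHom (hA : A.IsHermitian) (d : Fin p → ℝ) :
    star (spectralHom hA d) = spectralHom hA d := by
  rw [spectralHom_apply, star_mul, star_mul, star_star, Matrix.star_eq_conjTranspose (Matrix.diagonal d),
    Matrix.diagonal_conjTranspose, mul_assoc]
  simp

lemma posDef_spectralHom (hA : A.IsHermitian) {d : Fin p → ℝ} (hd : ∀ i, 0 < d i) :
    (spectralHom hA d).PosDef := by
  rw [spectralHom_apply, Matrix.IsUnit.posDef_star_right_conjugate_iff]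
  · exact Matrix.posDef_diagonal_iff.2 hd
  · exact (Unitary.toUnits hA.eigenvectorUnitary).isUnit

lemma spectralHom_inv (hA : A.IsHermitian) {d : Fin p → ℝ} (hd : ∀ i, d i ≠ 0) :
    (spectralHom hA d)⁻¹ = spectralHom hA fun i => (d i)⁻¹ := by
  refine Matrix.inv_eq_right_inv ?_
  rw [← map_mul, ← map_one (spectralHom hA)]
  congr 1
  funext i
  exact mul_inv_cancel₀ (hd i)

open scoped Matrix.Norms.L2Operator in
lemma norm_toEuclideanCLM_spectralHom (hA : A.IsHermitian) (d : Fin p → ℝ) :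
    ‖Matrix.toEuclideanCLM (𝕜 := ℝ) (spectralHom hA d)‖ = ‖d‖ := by
  rw [Matrix.l2_opNorm_toEuclideanCLM, spectralHom_apply, ← Unitary.coe_star,
    CStarRing.norm_mul_coe_unitary, CStarRing.norm_coe_unitary_mul, Matrix.l2_opNorm_diagonal]

lemma isLittleO_spectralHom (hA : A.IsHermitian) {l : Filter ℝ} {f : ℝ → Fin p → ℝ} {g : ℝ → ℝ}
    (h : ∀ i, (fun α => f α i) =o[l] g) (j k : Fin p) :
    (fun α => spectralHom hA (f α) j k) =o[l] g := by
  have h1 : ∀ d : Fin p → ℝ, spectralHom hA d j k =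
      ∑ i, (hA.eigenvectorUnitary : Matrix (Fin p) (Fin p) ℝ) j i *
        star (hA.eigenvectorUnitary : Matrix (Fin p) (Fin p) ℝ) i k * d i := by
    intro d
    rw [spectralHom_apply, Matrix.mul_apply]
    refine Finset.sum_congr rfl fun i _ => ?_
    rw [Matrix.mul_diagonal]; ring
  simp only [h1]
  exact Asymptotics.IsLittleO.fun_sum fun i _ => (h i).const_mul_left _

/-- On the positive spectrum `r ^ (-1/2) * r * r ^ (-1/2) = 1`, and the power is continuous there.
This identity whitens the limit covariance. -/
lemma invSqrt_mul_mul_invSqrt (hA : A.PosDef) : invSqrt A * A * invSqrt A = 1 := by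
  have hpos : ∀ r ∈ spectrum ℝ A, 0 < r := by
    intro r hr
    rw [hA.1.spectrum_real_eq_range_eigenvalues] at hr
    obtain ⟨i, rfl⟩ := hr
    exact hA.eigenvalues_pos i
  have hc : ContinuousOn (fun r : ℝ => r ^ (-(1 / 2) : ℝ)) (spectrum ℝ A) := fun r hr =>
    (Real.continuousAt_rpow_const r _ (Or.inl (hpos r hr).ne')).continuousWithinAt
  have hc2 : ContinuousOn (fun r : ℝ => r ^ (-(1 / 2) : ℝ) * r) (spectrum ℝ A) :=
    hc.mul (continuousOn_id' _)
  have hsa : IsSelfAdjoint A := hA.1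
  have h1 : A = cfc (fun r : ℝ => r) A := (cfc_id' ℝ A).symm
  unfold invSqrt
  nth_rewrite 2 [h1]
  rw [← cfc_mul _ _ A hc (continuousOn_id' _), ← cfc_mul _ _ A hc2 hc,
    ← cfc_one ℝ A]
  refine cfc_congr fun r hr => ?_
  have hr := hpos r hr
  simp only [Pi.one_apply]
  nth_rewrite 2 [← Real.rpow_one r]
  rw [← Real.rpow_add hr, ← Real.rpow_add hr]
  norm_num

lemma star_invSqrt (A : Matrix (Fin p) (Fin p) ℝ) : star (invSqrt A) = invSqrt A :=
  (cfc_predicate (R := ℝ) _ A : IsSelfAdjoint _)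

lemma mul_eigenvalues_lt_two (hA : A.PosDef) {α : ℝ} (hα : 0 < α) (hα2 : α < 2 / lambdaMax A)
    (i : Fin p) : α * hA.1.eigenvalues i < 2 := by
  have h1 : hA.1.eigenvalues i ≤ lambdaMax A := by
    unfold lambdaMax
    rw [hA.1.spectrum_real_eq_range_eigenvalues]
    exact le_csSup (Set.finite_range _).bddAbove (Set.mem_range_self i)
  have h2 := hA.eigenvalues_pos i
  have h3 : 0 < lambdaMax A := h2.trans_le h1
  calc _ ≤ α * lambdaMax A := by gcongr
    _ < 2 / lambdaMax A * lambdaMax A := by gcongr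
    _ = 2 := div_mul_cancel₀ _ h3.ne'

end Spectral

/-! ### The variance factor of an eigendirection. -/

section Scalar

open Finset

/-- The factor by which the asymptotic variance in the direction of an eigenvector exceeds that of
ordinary least squares, where `a = 1 - α * s` for the eigenvalue `s`. -/
def inflation (M : ℕ) (a : ℝ) : ℝ :=
  M * (∑ d ∈ range M, a ^ (2 * d)) / (∑ d ∈ range M, a ^ d) ^ 2

lemma sum_range_cast (M : ℕ) : ∑ d ∈ range M, (d : ℝ) = M * (M - 1) / 2 := by
  induction M with
  | zero => simp
  | succ n ih => rw [sum_range_succ, ih]; push_cast; ring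

lemma sum_range_cast_sq (M : ℕ) : ∑ d ∈ range M, (d : ℝ) ^ 2 = M * (M - 1) * (2 * M - 1) / 6 := by
  induction M with
  | zero => simp
  | succ n ih => rw [sum_range_succ, ih]; push_cast; ring

lemma sum_sum_sub_sq (M : ℕ) (f : ℕ → ℝ) :
    ∑ d ∈ range M, ∑ e ∈ range M, (f d - f e) ^ 2 =
      2 * (M * ∑ d ∈ range M, f d ^ 2 - (∑ d ∈ range M, f d) ^ 2) := by
  have h : ∀ d e, (f d - f e) ^ 2 = f d ^ 2 - 2 * f d * f e + f e ^ 2 := fun d e => by ring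
  simp only [h, sum_add_distrib, sum_sub_distrib, ← mul_sum, sum_const, card_range, nsmul_eq_mul,
    ← sum_mul]
  ring

/-- For negative `a` the terms alternate in sign, so positivity is read off from `(1 - a) * ∑ a ^ d
= 1 - a ^ M`. -/
lemma sum_geom_pos {M : ℕ} (hM : M ≠ 0) {a : ℝ} (ha : -1 < a) (ha1 : a < 1) :
    0 < ∑ d ∈ range M, a ^ d := by
  have h := mul_neg_geom_sum a M
  have h2 : 0 < 1 - a ^ M := by
    have : |a ^ M| < 1 := by
      rw [abs_pow]
      exact pow_lt_one₀ (abs_nonneg _) (abs_lt.2 ⟨ha, ha1⟩) hM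
    linarith [(abs_lt.1 this).2]
  rw [← h] at h2
  exact (pos_iff_pos_of_mul_pos h2).1 (by linarith)

lemma inflation_pos {M : ℕ} (hM : M ≠ 0) {a : ℝ} (ha : -1 < a) (ha1 : a < 1) :
    0 < inflation M a := by
  have h1 := sum_geom_pos hM ha ha1
  have h2 : 0 < ∑ d ∈ range M, a ^ (2 * d) := by
    obtain ⟨n, rfl⟩ := Nat.exists_eq_succ_of_ne_zero hM
    rw [sum_range_succ']
    have : 0 ≤ ∑ d ∈ range n, a ^ (2 * (d + 1)) :=
      sum_nonneg fun d _ => by rw [pow_mul]; positivity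
    simp only [mul_zero, pow_zero]; linarith
  have h3 : (0 : ℝ) < M := by positivity
  unfold inflation
  positivity

/-- Lagrange's identity writes the Cauchy–Schwarz defect as a sum of `(a ^ d - a ^ e) ^ 2`, and each
difference contains the factor `1 - a`. The remaining quotient is continuous at `a = 1`. -/
lemma inflation_sub_one {M : ℕ} {a : ℝ} (h : ∑ d ∈ range M, a ^ d ≠ 0) :
    inflation M a - 1 = (1 - a) ^ 2 * ((∑ d ∈ range M, ∑ e ∈ range M,
      (∑ i ∈ range e, a ^ i - ∑ i ∈ range d, a ^ i) ^ 2) / (2 * (∑ d ∈ range M, a ^ d) ^ 2)) := by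
  have h1 := sum_sum_sub_sq M fun d => a ^ d
  have h2 : ∑ d ∈ range M, ∑ e ∈ range M, (a ^ d - a ^ e) ^ 2 =
      (1 - a) ^ 2 * ∑ d ∈ range M, ∑ e ∈ range M,
        (∑ i ∈ range e, a ^ i - ∑ i ∈ range d, a ^ i) ^ 2 := by
    simp only [mul_sum]
    refine sum_congr rfl fun d _ => sum_congr rfl fun e _ => ?_
    rw [← mul_pow, mul_sub, mul_neg_geom_sum, mul_neg_geom_sum]
    ring
  have h3 : ∀ d, (a ^ d) ^ 2 = a ^ (2 * d) := fun d => by rw [← pow_mul, mul_comm]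
  simp only [h3] at h1
  rw [inflation, ← mul_div_assoc, ← h2, h1]
  field_simp

lemma tendsto_inflation {M : ℕ} (hM : M ≠ 0) :
    Tendsto (fun a => (inflation M a - 1) / (1 - a) ^ 2) (𝓝[≠] 1) (𝓝 (((M : ℝ) ^ 2 - 1) / 12)) := by
  set D : ℝ → ℝ := fun a => (∑ d ∈ range M, ∑ e ∈ range M,
      (∑ i ∈ range e, a ^ i - ∑ i ∈ range d, a ^ i) ^ 2) / (2 * (∑ d ∈ range M, a ^ d) ^ 2) with hD
  have hM' : (M : ℝ) ≠ 0 := by exact_mod_cast hM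
  have hS : ContinuousAt (fun a : ℝ => ∑ d ∈ range M, a ^ d) 1 := by fun_prop
  have hDc : ContinuousAt D 1 := by
    refine ContinuousAt.div (by fun_prop) (by fun_prop) ?_
    simpa using hM
  -- At `a = 1` the quotient is `∑ (d - e) ^ 2 / (2 M ^ 2)`, the variance of the uniform
  -- distribution on `0, …, M - 1`.
  have hD1 : D 1 = ((M : ℝ) ^ 2 - 1) / 12 := by
    have := sum_sum_sub_sq M fun d => (d : ℝ)
    rw [sum_range_cast, sum_range_cast_sq, sum_comm] at this
    simp only [hD, one_pow, sum_const, card_range, nsmul_eq_mul, mul_one]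
    rw [this]
    field_simp; ring
  rw [← hD1]
  refine (hDc.tendsto.mono_left nhdsWithin_le_nhds).congr' ?_
  have hne : ∀ᶠ a in 𝓝[≠] (1 : ℝ), ∑ d ∈ range M, a ^ d ≠ 0 :=
    nhdsWithin_le_nhds (hS.eventually_ne (by simpa using hM))
  filter_upwards [hne, self_mem_nhdsWithin] with a ha ha1
  have : 1 - a ≠ 0 := sub_ne_zero.2 (Ne.symm ha1)
  rw [inflation_sub_one ha, mul_comm, mul_div_assoc, div_self (pow_ne_zero 2 this), mul_one]

lemma isLittleO_inflation {M : ℕ} (hM : M ≠ 0) {s : ℝ} (hs : 0 < s) :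
    (fun α : ℝ => s⁻¹ * inflation M (1 - α * s) - (s⁻¹ + α ^ 2 * ((M : ℝ) ^ 2 - 1) / 12 * s))
      =o[𝓝[>] 0] fun α : ℝ => α ^ 2 := by
  have hpos : ∀ᶠ α : ℝ in 𝓝[>] 0, 0 < α := self_mem_nhdsWithin
  rw [Asymptotics.isLittleO_iff_tendsto' (hpos.mono fun α hα h => by
    exact absurd h (by positivity))]
  have h1 : Tendsto (fun α : ℝ => 1 - α * s) (𝓝[>] 0) (𝓝[≠] 1) := by
    refine tendsto_nhdsWithin_iff.2 ⟨?_, hpos.mono fun α hα => ?_⟩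
    · have : Continuous fun α : ℝ => 1 - α * s := by fun_prop
      simpa using (this.tendsto 0).mono_left (nhdsWithin_le_nhds (s := Set.Ioi 0))
    · have : 0 < α * s := by positivity
      simp [hα.ne', hs.ne']
  have h2 := (((tendsto_inflation hM).comp h1).sub_const (((M : ℝ) ^ 2 - 1) / 12)).const_mul s
  rw [sub_self, mul_zero] at h2
  refine h2.congr' (hpos.mono fun α hα => ?_)
  simp only [Function.comp, sub_sub_cancel]
  field_simp
  ring

end Scalar

end FMGD

namespace FMGD

/-! ### Limits of the coefficients. -/

section Limit

variable {p M : ℕ} {A : Matrix (Fin p) (Fin p) ℝ}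

/-- The asymptotic variance, up to the factor `σ ^ 2`, of the estimator with learning rate `α`. -/
def asympVar (M : ℕ) (hA : A.IsHermitian) (α : ℝ) : Matrix (Fin p) (Fin p) ℝ :=
  spectralHom hA fun i => (hA.eigenvalues i)⁻¹ * inflation M (1 - α * hA.eigenvalues i)

lemma isLittleO_asympVar (hM : M ≠ 0) (hA : A.PosDef) (j k : Fin p) :
    (fun α : ℝ => asympVar M hA.1 α j k -
      (A⁻¹ + (α ^ 2 * ((M : ℝ) ^ 2 - 1) / 12) • A) j k) =o[𝓝[>] 0] fun α : ℝ => α ^ 2 := by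
  have h := isLittleO_spectralHom hA.1 (fun i => isLittleO_inflation hM (hA.eigenvalues_pos i)) j k
  refine h.congr_left fun α => ?_
  have h1 : A⁻¹ = spectralHom hA.1 fun i => (hA.1.eigenvalues i)⁻¹ := by
    rw [← spectralHom_inv hA.1 fun i => (hA.eigenvalues_pos i).ne', spectralHom_eigenvalues]
  have h2 : (α ^ 2 * ((M : ℝ) ^ 2 - 1) / 12) • A =
      spectralHom hA.1 ((α ^ 2 * ((M : ℝ) ^ 2 - 1) / 12) • hA.1.eigenvalues) := by
    rw [map_smul, spectralHom_eigenvalues]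
  rw [asympVar, ← Matrix.sub_apply, h1, h2, ← map_add, ← map_sub]
  rfl

lemma posDef_asympVar (hM : M ≠ 0) (hA : A.PosDef) {α : ℝ} (hα : 0 < α)
    (hα2 : α < 2 / lambdaMax A) : (asympVar M hA.1 α).PosDef := by
  refine posDef_spectralHom _ fun i => ?_
  have h1 := hA.eigenvalues_pos i
  have h2 := mul_eigenvalues_lt_two hA hα hα2 i
  have h3 : 0 < α * hA.1.eigenvalues i := by positivity
  exact mul_pos (inv_pos.2 h1) (inflation_pos hM (by linarith) (by linarith))

/-- `spectralHom` with values in the operators. -/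
def opHom (hA : A.IsHermitian) : (Fin p → ℝ) →ₐ[ℝ] (Vec p →L[ℝ] Vec p) :=
  (Matrix.toEuclideanCLM (n := Fin p) (𝕜 := ℝ)).toAlgEquiv.toAlgHom.comp (spectralHom hA)

lemma opHom_apply (hA : A.IsHermitian) (d : Fin p → ℝ) :
    opHom hA d = Matrix.toEuclideanCLM (𝕜 := ℝ) (spectralHom hA d) := rfl

lemma adjoint_opHom (hA : A.IsHermitian) (d : Fin p → ℝ) :
    ContinuousLinearMap.adjoint (opHom hA d) = opHom hA d := by
  rw [← ContinuousLinearMap.star_eq_adjoint, opHom_apply, ← map_star, star_spectralHom]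

lemma one_sub_smul_eq_opHom (hA : A.IsHermitian) (α : ℝ) :
    1 - α • Matrix.toEuclideanCLM (𝕜 := ℝ) A =
      opHom hA fun i => 1 - α * hA.eigenvalues i := by
  have h : (fun i => 1 - α * hA.eigenvalues i) = 1 - α • hA.eigenvalues := rfl
  rw [h, map_sub, map_one, map_smul, opHom_apply, spectralHom_eigenvalues]

lemma norm_one_sub_smul_lt_one (hA : A.PosDef) {α : ℝ} (hα : 0 < α) (hα2 : α < 2 / lambdaMax A) :
    ‖1 - α • Matrix.toEuclideanCLM (𝕜 := ℝ) A‖ < 1 := by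
  rw [one_sub_smul_eq_opHom hA.1, opHom_apply, norm_toEuclideanCLM_spectralHom,
    pi_norm_lt_iff one_pos]
  intro i
  have h1 := hA.eigenvalues_pos i
  have h2 := mul_eigenvalues_lt_two hA hα hα2 i
  have h3 : 0 < α * hA.1.eigenvalues i := by positivity
  rw [Real.norm_eq_abs, abs_lt]
  constructor <;> linarith

/-- With `a = 1 - α s`, the factorization `1 - a ^ M = α s ∑ a ^ d` cancels `α ^ 2` and leaves
`s⁻¹`. -/
lemma sum_gain_sq (hM : M ≠ 0) (hA : A.PosDef) {α : ℝ} (hα : 0 < α) (hα2 : α < 2 / lambdaMax A)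
    (i : Fin p) :
    M * α ^ 2 * ∑ j : Fin M, ((1 - (1 - α * hA.1.eigenvalues i) ^ M)⁻¹ *
        (1 - α * hA.1.eigenvalues i) ^ (M - 1 - (j : ℕ))) ^ 2 * hA.1.eigenvalues i =
      (hA.1.eigenvalues i)⁻¹ * inflation M (1 - α * hA.1.eigenvalues i) := by
  have h1 := hA.eigenvalues_pos i
  have h2 := mul_eigenvalues_lt_two hA hα hα2 i
  have h3 : 0 < α * hA.1.eigenvalues i := by positivity
  set s := hA.1.eigenvalues i
  have hS := sum_geom_pos hM (a := 1 - α * s) (by linarith) (by linarith)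
  have hg : 1 - (1 - α * s) ^ M = α * s * ∑ d ∈ Finset.range M, (1 - α * s) ^ d := by
    rw [← mul_neg_geom_sum]; ring
  have hQ : ∑ j : Fin M, ((1 - α * s) ^ (M - 1 - (j : ℕ))) ^ 2 =
      ∑ d ∈ Finset.range M, (1 - α * s) ^ (2 * d) := by
    rw [← Finset.sum_range_reflect, ← Finset.sum_range
      fun j => ((1 - α * s) ^ (M - 1 - j)) ^ 2]
    refine Finset.sum_congr rfl fun j _ => ?_
    rw [← pow_mul, Nat.mul_comm]
  simp only [mul_pow]
  rw [inflation, ← Finset.sum_mul, ← Finset.mul_sum, hQ, hg]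
  field_simp

variable [NeZero M]

/-- The operator that maps `x i` to a multiple of `coef α x b m i` if the sample `i` is used `j`
updates after the one that follows the mini-batch `m`. -/
def gain {N : ℕ} (α : ℝ) (x : Fin N → Vec p) (b : Fin N → Fin M) (m j : Fin M) :
    Vec p →L[ℝ] Vec p :=
  Ring.inverse (1 - ordProd (stepOp α x b m) 0 M) *
    ordProd (stepOp α x b m) ((j : ℕ) + 1) (M - 1 - j)

lemma coef_eq_gain {N : ℕ} (α : ℝ) (x : Fin N → Vec p) (b : Fin N → Fin M) (m : Fin M)
    (i : Fin N) : coef α x b m i =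
      (α * ((Finset.univ.filter fun i' => b i' = b i).card : ℝ)⁻¹) •
        gain α x b m (b i - (m + 1)) (x i) := rfl

/-- Within a batch the gain operator is constant, so the squares sum to `n` times a quadratic form
of `batchCov`; the scalar is `n M * (α / n) ^ 2 * n = M α ^ 2`. -/
lemma sum_inner_coef_sq {n : ℕ} (hn : n ≠ 0) (α : ℝ) (x : Fin (n * M) → Vec p)
    (b : Fin (n * M) → Fin M) (hcard : ∀ k, (Finset.univ.filter fun i => b i = k).card = n)
    (m : Fin M) (r : Vec p) :
    ∑ i, ⟪√((n * M : ℕ) : ℝ) • coef α x b m i, r⟫ ^ 2 =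
      M * α ^ 2 * ∑ j, ⟪ContinuousLinearMap.adjoint (gain α x b m j) r,
        batchCov x b (j + (m + 1)) (ContinuousLinearMap.adjoint (gain α x b m j) r)⟫ := by
  rw [← Finset.sum_fiberwise (s := Finset.univ) (g := b),
    ← Equiv.sum_comp (Equiv.addRight (m + 1)), Finset.mul_sum]
  refine Finset.sum_congr rfl fun j _ => ?_
  rw [Equiv.coe_addRight, inner_batchCov, hcard, Finset.mul_sum, Finset.mul_sum]
  refine Finset.sum_congr rfl fun i hi => ?_
  have hi : b i = j + (m + 1) := (Finset.mem_filter.1 hi).2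
  rw [coef_eq_gain, hi, hcard, add_sub_cancel_right, inner_smul_left, inner_smul_left,
    ContinuousLinearMap.adjoint_inner_left, mul_pow, real_inner_comm]
  simp only [conj_trivial]
  have hn' : (n : ℝ) ≠ 0 := by exact_mod_cast hn
  push_cast
  rw [mul_pow, Real.sq_sqrt (by positivity)]
  field_simp

/-- All factors of the ordered products share one limit, so the products tend to its powers.
Inversion is continuous at `1 - opHom hA.1 a ^ M`, which is invertible because `|a i| < 1`. -/
lemma tendsto_gain (hA : A.PosDef) {x : ∀ n, Fin (n * M) → Vec p} {b : ∀ n, Fin (n * M) → Fin M}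
    (hH : ∀ k, Tendsto (fun n => batchCov (x n) (b n) k) atTop
      (𝓝 (Matrix.toEuclideanCLM (𝕜 := ℝ) A)))
    {α : ℝ} (hα : 0 < α) (hα2 : α < 2 / lambdaMax A) (m j : Fin M) :
    Tendsto (fun n => gain α (x n) (b n) m j) atTop
      (𝓝 (opHom hA.1 fun i => (1 - (1 - α * hA.1.eigenvalues i) ^ M)⁻¹ *
        (1 - α * hA.1.eigenvalues i) ^ (M - 1 - (j : ℕ)))) := by
  have hM : M ≠ 0 := NeZero.ne M
  set a : Fin p → ℝ := fun i => 1 - α * hA.1.eigenvalues i with ha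
  have ha1 : ∀ i, |a i| < 1 := fun i => by
    have h1 := hA.eigenvalues_pos i
    have h2 := mul_eigenvalues_lt_two hA hα hα2 i
    have h3 : 0 < α * hA.1.eigenvalues i := by positivity
    rw [abs_lt]; constructor <;> simp only [ha] <;> linarith
  have hne : ∀ i, 1 - a i ^ M ≠ 0 := fun i => by
    have : |a i ^ M| < 1 := by
      rw [abs_pow]; exact pow_lt_one₀ (abs_nonneg _) (ha1 i) hM
    linarith [(abs_lt.1 this).2]
  have hstep : ∀ i, Tendsto (fun n => stepOp α (x n) (b n) m i) atTop (𝓝 (opHom hA.1 a)) := by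
    intro i
    rw [ha, ← one_sub_smul_eq_opHom]
    exact tendsto_const_nhds.sub ((hH _).const_smul α)
  have h1 := fun d => tendsto_ordProd hstep d
  have hinv : (1 - opHom hA.1 a ^ M) * (opHom hA.1 fun i => (1 - a i ^ M)⁻¹) = 1 := by
    rw [← map_pow, ← map_one (opHom hA.1), ← map_sub, ← map_mul]
    congr 1
    funext i
    exact mul_inv_cancel₀ (hne i)
  have hinv' : (opHom hA.1 fun i => (1 - a i ^ M)⁻¹) * (1 - opHom hA.1 a ^ M) = 1 := by
    rw [← map_pow, ← map_one (opHom hA.1), ← map_sub, ← map_mul]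
    congr 1
    funext i
    exact inv_mul_cancel₀ (hne i)
  have h2 : Tendsto (fun n => Ring.inverse (1 - ordProd (stepOp α (x n) (b n) m) 0 M)) atTop
      (𝓝 (opHom hA.1 fun i => (1 - a i ^ M)⁻¹)) := by
    have h3 := (NormedRing.inverse_continuousAt
      (⟨1 - opHom hA.1 a ^ M, _, hinv, hinv'⟩ : (Vec p →L[ℝ] Vec p)ˣ)).tendsto
    rw [Ring.inverse_unit] at h3
    exact h3.comp (tendsto_const_nhds.sub (h1 0 M))
  have h4 := h2.mul (h1 ((j : ℕ) + 1) (M - 1 - j))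
  rw [← map_pow, ← map_mul] at h4
  exact h4

/-- The coefficients satisfy the hypotheses of the central limit theorem for triangular arrays. -/
lemma tendsto_sum_coef_sq (hA : A.PosDef) {x : ∀ n, Fin (n * M) → Vec p}
    {b : ∀ n, Fin (n * M) → Fin M}
    (hcard : ∀ n k, (Finset.univ.filter fun i => b n i = k).card = n)
    (hH : ∀ k, Tendsto (fun n => batchCov (x n) (b n) k) atTop
      (𝓝 (Matrix.toEuclideanCLM (𝕜 := ℝ) A)))
    {α : ℝ} (hα : 0 < α) (hα2 : α < 2 / lambdaMax A) (m : Fin M) (r : Vec p) :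
    Tendsto (fun n => ∑ i, ⟪√((n * M : ℕ) : ℝ) • coef α (x n) (b n) m i, r⟫ ^ 2) atTop
      (𝓝 ⟪r, Matrix.toEuclideanCLM (𝕜 := ℝ) (asympVar M hA.1 α) r⟫) := by
  have hM : M ≠ 0 := NeZero.ne M
  have h1 : (fun n => M * α ^ 2 * ∑ j, ⟪ContinuousLinearMap.adjoint (gain α (x n) (b n) m j) r,
        batchCov (x n) (b n) (j + (m + 1))
          (ContinuousLinearMap.adjoint (gain α (x n) (b n) m j) r)⟫) =ᶠ[atTop]
      fun n => ∑ i, ⟪√((n * M : ℕ) : ℝ) • coef α (x n) (b n) m i, r⟫ ^ 2 := by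
    filter_upwards [eventually_ne_atTop 0] with n hn
    rw [sum_inner_coef_sq hn α (x n) (b n) (hcard n) m r]
  refine Tendsto.congr' h1 ?_
  have h2 : ⟪r, Matrix.toEuclideanCLM (𝕜 := ℝ) (asympVar M hA.1 α) r⟫ =
      M * α ^ 2 * ∑ j : Fin M, ⟪opHom hA.1 (fun i => (1 - (1 - α * hA.1.eigenvalues i) ^ M)⁻¹ *
          (1 - α * hA.1.eigenvalues i) ^ (M - 1 - (j : ℕ))) r,
        Matrix.toEuclideanCLM (𝕜 := ℝ) A (opHom hA.1 (fun i =>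
          (1 - (1 - α * hA.1.eigenvalues i) ^ M)⁻¹ *
          (1 - α * hA.1.eigenvalues i) ^ (M - 1 - (j : ℕ))) r)⟫ := by
    have h3 : ∀ g : Fin p → ℝ, ⟪opHom hA.1 g r, Matrix.toEuclideanCLM (𝕜 := ℝ) A (opHom hA.1 g r)⟫ =
        ⟪r, opHom hA.1 (g ^ 2 * hA.1.eigenvalues) r⟫ := by
      intro g
      have h4 : Matrix.toEuclideanCLM (𝕜 := ℝ) A = opHom hA.1 hA.1.eigenvalues := by
        rw [opHom_apply, spectralHom_eigenvalues]
      rw [h4, ← ContinuousLinearMap.adjoint_inner_right, adjoint_opHom,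
        show g ^ 2 * hA.1.eigenvalues = g * (hA.1.eigenvalues * g) by ring, map_mul, map_mul]
      rfl
    simp only [h3]
    rw [← inner_sum, ← inner_smul_right, ← sum_apply,
      ← smul_apply, ← map_sum, ← map_smul, asympVar, ← opHom_apply]
    congr 3
    funext i
    rw [← sum_gain_sq hM hA hα hα2 i]
    simp
  rw [h2]
  refine Tendsto.const_mul _ (tendsto_finsetSum _ fun j _ => ?_)
  have h5 : Tendsto (fun n => ContinuousLinearMap.adjoint (gain α (x n) (b n) m j)) atTop _ :=
    ((ContinuousLinearMap.adjoint (𝕜 := ℝ) (E := Vec p) (F := Vec p)).continuous.tendsto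
      _).comp (tendsto_gain hA hH hα hα2 m j)
  rw [adjoint_opHom] at h5
  have happ : Continuous fun q : (Vec p →L[ℝ] Vec p) × Vec p => q.1 q.2 := by fun_prop
  have h6 := (happ.tendsto _).comp (h5.prodMk_nhds (tendsto_const_nhds (x := r)))
  exact h6.inner ((happ.tendsto _).comp ((hH _).prodMk_nhds h6))

/-- Asymptotic negligibility: the gains stay bounded, so the size is `√(n M) * (α / n) * o(√n)`,
which tends to zero. -/
lemma eventually_abs_inner_coef_le (hA : A.PosDef) {x : ∀ n, Fin (n * M) → Vec p}
    {b : ∀ n, Fin (n * M) → Fin M}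
    (hcard : ∀ n k, (Finset.univ.filter fun i => b n i = k).card = n)
    (hH : ∀ k, Tendsto (fun n => batchCov (x n) (b n) k) atTop
      (𝓝 (Matrix.toEuclideanCLM (𝕜 := ℝ) A)))
    (hx : ∀ η : ℝ, 0 < η → ∀ᶠ n : ℕ in atTop, ∀ i, ‖x n i‖ ≤ η * √n)
    {α : ℝ} (hα : 0 < α) (hα2 : α < 2 / lambdaMax A) (m : Fin M) (r : Vec p) {η : ℝ}
    (hη : 0 < η) :
    ∀ᶠ n : ℕ in atTop, ∀ i, |⟪√((n * M : ℕ) : ℝ) • coef α (x n) (b n) m i, r⟫| ≤ η := by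
  have hM : (0 : ℝ) < M := by exact_mod_cast (NeZero.ne M).bot_lt
  have h1 : ∃ C : ℝ, 0 < C ∧ ∀ᶠ n in atTop, ∀ j, ‖gain α (x n) (b n) m j‖ ≤ C := by
    choose C hC using fun j => (tendsto_gain hA hH hα hα2 m j).norm.isBoundedUnder_le
    refine ⟨1 + ∑ j, |C j|, by positivity, ?_⟩
    refine eventually_all.2 fun j => ?_
    filter_upwards [eventually_map.1 (hC j)] with n hn
    have := Finset.single_le_sum (f := fun j => |C j|) (fun _ _ => abs_nonneg _)
      (Finset.mem_univ j)
    have h3 := le_abs_self (C j)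
    linarith
  obtain ⟨C, hC, hb⟩ := h1
  -- The summand `1` keeps `D` positive when `r = 0`.
  set D : ℝ := √M * α * C * (‖r‖ + 1) with hD
  have hD0 : 0 < D := by positivity
  filter_upwards [hb, hx (η / D) (by positivity), eventually_gt_atTop 0] with n hn1 hn2 hn3 i
  have hn0 : (0 : ℝ) < n := by exact_mod_cast hn3
  have hsn : 0 < √(n : ℝ) := Real.sqrt_pos.2 hn0
  have hsq : √(n : ℝ) * √(n : ℝ) = n := Real.mul_self_sqrt hn0.le
  refine (abs_real_inner_le_norm _ _).trans ?_
  rw [coef_eq_gain, hcard, norm_smul, norm_smul, Real.norm_of_nonneg (by positivity),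
    Real.norm_of_nonneg (by positivity)]
  push_cast
  rw [Real.sqrt_mul hn0.le]
  calc √(n : ℝ) * √(M : ℝ) * (α * (n : ℝ)⁻¹ * ‖gain α (x n) (b n) m (b n i - (m + 1)) (x n i)‖) * ‖r‖
      ≤ √(n : ℝ) * √(M : ℝ) * (α * (n : ℝ)⁻¹ * (C * (η / D * √(n : ℝ)))) * (‖r‖ + 1) := by
        gcongr
        · exact (ContinuousLinearMap.le_opNorm _ _).trans
            (mul_le_mul (hn1 _) (hn2 i) (norm_nonneg _) hC.le)
        · linarith
    _ = (√(n : ℝ) * √(n : ℝ)) * (n : ℝ)⁻¹ * (√(M : ℝ) * α * C * (‖r‖ + 1)) * (η / D) := by ring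
    _ = η := by
      rw [hsq, ← hD]
      field_simp

end Limit

end FMGD

namespace FMGD

/-! ### Measurability and the conditional law of the estimator. -/

section Measurability

variable {p N M : ℕ}

lemma continuous_batchCov (b : Fin N → Fin M) (k : Fin M) :
    Continuous fun x : Fin N → Vec p => batchCov x b k := by
  have h : ∀ i : Fin N, Continuous fun x : Fin N → Vec p => (innerSL ℝ (x i)).smulRight (x i) :=
    fun i => by fun_prop
  have h2 : Continuous fun x : Fin N → Vec p =>
      ∑ i ∈ Finset.univ.filter fun i => b i = k, (innerSL ℝ (x i)).smulRight (x i) :=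
    continuous_finsetSum _ fun i _ => h i
  exact h2.const_smul (((Finset.univ.filter fun i => b i = k).card : ℝ)⁻¹)

lemma measurableSet_contracting (α : ℝ) :
    MeasurableSet {d : (Fin N → Vec p) × (Fin N → Fin M) | Contracting α d.1 d.2} := by
  have h : ∀ k : Fin M, Measurable fun d : (Fin N → Vec p) × (Fin N → Fin M) =>
      ‖(1 : Vec p →L[ℝ] Vec p) - α • batchCov d.1 d.2 k‖ := fun k =>
    measurable_from_prod_countable_left fun b => Continuous.measurable <|
      (continuous_const.sub ((continuous_batchCov b k).const_smul α)).norm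
  have h2 : {d : (Fin N → Vec p) × (Fin N → Fin M) | Contracting α d.1 d.2} =
      ⋂ k, {d | ‖(1 : Vec p →L[ℝ] Vec p) - α • batchCov d.1 d.2 k‖ < 1} := by
    ext d; simp [Contracting]
  rw [h2]
  exact MeasurableSet.iInter fun k => measurableSet_lt (h k) measurable_const

lemma measurable_design {Ω : Type*} [MeasurableSpace Ω] {X : ℕ → Ω → Vec p}
    {B : Ω → Fin N → Fin M} (hX : ∀ i, Measurable (X i)) (hB : Measurable B) :
    Measurable (design (N := N) X B) := by
  have h2 : Measurable fun ω (i : Fin N) => X i ω := measurable_pi_lambda _ fun i => hX i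
  exact h2.prodMk hB

variable [NeZero M]

lemma continuous_iter (α : ℝ) (b : Fin N → Fin M) (s : ℕ) :
    Continuous fun q : (Fin N → Vec p) × (Fin N → ℝ) × Vec p => iter α q.1 q.2.1 b q.2.2 s := by
  induction s with
  | zero => exact continuous_snd.snd
  | succ s ih =>
    simp only [iter, batchGrad]
    fun_prop

/-- The set of convergence is measurable, and the estimator is the pointwise limit of the iterates
set to `0` outside it, in agreement with the default value. -/
lemma measurable_estimator (α : ℝ) (m : Fin M) :
    Measurable fun q : (Fin N → Fin M) × (Fin N → Vec p) × (Fin N → ℝ) × Vec p =>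
      estimator α q.2.1 q.2.2.1 q.1 q.2.2.2 m := by
  refine measurable_from_prod_countable_right fun b => ?_
  have hc : ∀ t, Measurable fun q : (Fin N → Vec p) × (Fin N → ℝ) × Vec p =>
      epochIter α q.1 q.2.1 b q.2.2 m t := fun t => (continuous_iter α b _).measurable
  have hS := measurableSet_exists_tendsto (l := atTop) hc
  refine measurable_of_tendsto_metrizable (fun t => (hc t).indicator hS)
    (tendsto_pi_nhds.2 fun q => ?_)
  by_cases hq : ∃ l, Tendsto (fun t => epochIter α q.1 q.2.1 b q.2.2 m t) atTop (𝓝 l)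
  · have h1 := hq.choose_spec
    simp only [estimator]
    rw [dif_pos hq]
    refine h1.congr fun t => ?_
    rw [Set.indicator_of_mem]; exact hq
  · simp only [estimator]
    rw [dif_neg hq]
    refine tendsto_const_nhds.congr fun t => ?_
    rw [Set.indicator_of_notMem]; exact hq

variable {Ω : Type*} [MeasurableSpace Ω] {P : Measure Ω} [IsProbabilityMeasure P]
  {X : ℕ → Ω → Vec p} {ε : ℕ → Ω → ℝ} {θ : Vec p} {B : Ω → Fin N → Fin M} {ϑ₀ : Ω → Vec p}

lemma measurable_thetaHat (hX : ∀ i, Measurable (X i)) (hε : ∀ i, Measurable (ε i))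
    (hB : Measurable B) (hϑ₀ : Measurable ϑ₀) (α : ℝ) (m : Fin M) :
    Measurable (thetaHat X ε θ B ϑ₀ α m) := by
  have h1 : Measurable fun ω => (B ω, (fun i : Fin N => X i ω),
      (fun i : Fin N => ⟪X i ω, θ⟫ + ε i ω), ϑ₀ ω) := by
    have h2 : Measurable fun ω (i : Fin N) => X i ω := measurable_pi_lambda _ fun i => hX i
    have h3 : Measurable fun ω (i : Fin N) => ⟪X i ω, θ⟫ + ε i ω := by
      refine measurable_pi_lambda _ fun i => ?_
      exact ((hX i).inner (measurable_const (a := θ))).add (hε i)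
    exact hB.prodMk (h2.prodMk (h3.prodMk hϑ₀))
  have h4 := (measurable_estimator (p := p) α m).comp h1
  exact h4

lemma measurable_muHat (hX : ∀ i, Measurable (X i)) (hB : Measurable B) (α : ℝ) (m : Fin M) :
    Measurable (muHat P X ε θ B ϑ₀ α m) :=
  ((StronglyMeasurable.integral_condDistrib (μ := P) (X := design X B)
    (Y := thetaHat X ε θ B ϑ₀ α m) (f := fun q : _ × Vec p => q.2)
    measurable_snd.stronglyMeasurable).measurable).comp (measurable_design hX hB)

lemma measurable_standardized (hX : ∀ i, Measurable (X i)) (hε : ∀ i, Measurable (ε i))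
    (hB : Measurable B) (hϑ₀ : Measurable ϑ₀) (α : ℝ) (m : Fin M)
    (V : Matrix (Fin p) (Fin p) ℝ) : Measurable (standardized P X ε θ B ϑ₀ α m V) := by
  have h := (measurable_thetaHat (θ := θ) hX hε hB hϑ₀ α m).sub
    (measurable_muHat (P := P) (ε := ε) (θ := θ) (ϑ₀ := ϑ₀) hX hB α m)
  exact (((Matrix.toEuclideanCLM (𝕜 := ℝ) (invSqrt V)).continuous.measurable).comp h).const_smul
    (√(N : ℝ))

/-- For contracting designs, the conditional distribution of a function of the estimator given the
design is the distribution of this function of a linear form in the noise. -/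
lemma condDistrib_comp_thetaHat (hX : ∀ i, Measurable (X i)) (hε : ∀ i, Measurable (ε i))
    (hB : Measurable B) (hind : IndepFun (design X B) (fun ω (i : Fin N) => ε i ω) P)
    (α : ℝ) (m : Fin M) {F : Vec p → Vec p} (hF : Measurable F) {Z : Ω → Vec p}
    (hZm : Measurable Z)
    (hZ : ∀ᵐ ω ∂P, Contracting α (fun i : Fin N => X i ω) (B ω) →
      Z ω = F (thetaHat X ε θ B ϑ₀ α m ω)) :
    ∀ᵐ ω ∂P, Contracting α (fun i : Fin N => X i ω) (B ω) →
      condDistrib Z (design X B) P (design X B ω) =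
        P.map fun ω' => F (θ + ∑ i : Fin N, ε i ω' • coef α (fun i => X i ω) (B ω) m i) := by
  -- For contracting designs the initial value has no influence, so it is replaced by `0`; the true
  -- one may depend on the data.
  let f : ((Fin N → Vec p) × (Fin N → Fin M)) × (Fin N → ℝ) → Vec p := fun q =>
    F (estimator α q.1.1 (fun i => ⟪q.1.1 i, θ⟫ + q.2 i) q.1.2 0 m)
  have hf : Measurable f := by
    have h1 : Measurable fun q : ((Fin N → Vec p) × (Fin N → Fin M)) × (Fin N → ℝ) =>
        (q.1.2, q.1.1, (fun i => ⟪q.1.1 i, θ⟫ + q.2 i), (0 : Vec p)) := by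
      have h2 : Measurable fun q : ((Fin N → Vec p) × (Fin N → Fin M)) × (Fin N → ℝ) =>
          fun i => ⟪q.1.1 i, θ⟫ + q.2 i := by
        refine measurable_pi_lambda _ fun i => ?_
        have h3 : Measurable fun q : ((Fin N → Vec p) × (Fin N → Fin M)) × (Fin N → ℝ) =>
            q.1.1 i := by fun_prop
        exact (h3.inner (measurable_const (a := θ))).add (by fun_prop)
      exact measurable_fst.snd.prodMk (measurable_fst.fst.prodMk (h2.prodMk measurable_const))
    have h4 := hF.comp ((measurable_estimator (p := p) α m).comp h1)
    exact h4
  have hf' : ∀ d e, Contracting α d.1 d.2 →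
      f (d, e) = F (θ + ∑ i, e i • coef α d.1 d.2 m i) := by
    intro d e hd
    simp only [f]
    rw [estimator_eq α d.1 e θ d.2 0 m hd]
  have hZ' : ∀ᵐ ω ∂P, design X B ω ∈ {d | Contracting α d.1 d.2} →
      Z ω = f (design X B ω, fun i : Fin N => ε i ω) := by
    filter_upwards [hZ] with ω h1 h2
    rw [hf' _ _ h2, h1 h2, thetaHat,
      estimator_eq α (fun i : Fin N => X i ω) (fun i : Fin N => ε i ω) θ (B ω) _ m h2]
    rfl
  have he : Measurable fun ω (i : Fin N) => ε i ω := measurable_pi_lambda _ fun i => hε i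
  have h := condDistrib_ae_eq_map_of_indepFun (measurable_design hX hB) he hZm hf
    (measurableSet_contracting α) hind hZ'
  filter_upwards [h] with ω hω hc
  rw [hω hc]
  congr 1
  funext ω'
  exact hf' _ _ hc

lemma muHat_eq_of_contracting (hX : ∀ i, Measurable (X i)) (hε : ∀ i, Measurable (ε i))
    (hB : Measurable B) (hϑ₀ : Measurable ϑ₀)
    (hind : IndepFun (design X B) (fun ω (i : Fin N) => ε i ω) P)
    (hint : ∀ i, Integrable (ε i) P) (h0 : ∀ i, ∫ ω, ε i ω ∂P = 0) (α : ℝ) (m : Fin M) :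
    ∀ᵐ ω ∂P, Contracting α (fun i : Fin N => X i ω) (B ω) →
      muHat P X ε θ B ϑ₀ α m ω = θ := by
  have h := condDistrib_comp_thetaHat (θ := θ) (ϑ₀ := ϑ₀) hX hε hB hind α m (F := id)
    measurable_id (measurable_thetaHat hX hε hB hϑ₀ α m) (ae_of_all _ fun _ _ => rfl)
  filter_upwards [h] with ω hω hc
  rw [muHat, hω hc]
  have hm : Measurable fun ω' => id (θ + ∑ i : Fin N, ε i ω' •
      coef α (fun i => X i ω) (B ω) m i) :=
    measurable_const.add (Finset.measurable_sum _ fun i _ => (hε i).smul_const _)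
  rw [integral_map hm.aemeasurable (by fun_prop)]
  simp only [id]
  have hi : ∀ i : Fin N, Integrable (fun ω' => ε i ω' • coef α (fun i : Fin N => X i ω) (B ω) m i) P :=
    fun i => (hint i).smul_const _
  rw [integral_add (integrable_const _) (integrable_finsetSum _ fun i _ => hi i),
    integral_finsetSum _ fun i _ => hi i]
  simp [integral_smul_const, h0]

lemma condDistrib_standardized (hX : ∀ i, Measurable (X i)) (hε : ∀ i, Measurable (ε i))
    (hB : Measurable B) (hϑ₀ : Measurable ϑ₀)
    (hind : IndepFun (design X B) (fun ω (i : Fin N) => ε i ω) P)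
    (hint : ∀ i, Integrable (ε i) P) (h0 : ∀ i, ∫ ω, ε i ω ∂P = 0) (α : ℝ) (m : Fin M)
    (V : Matrix (Fin p) (Fin p) ℝ) :
    ∀ᵐ ω ∂P, Contracting α (fun i : Fin N => X i ω) (B ω) →
      condDistrib (standardized P X ε θ B ϑ₀ α m V) (design X B) P (design X B ω) =
        P.map fun ω' => ∑ i : Fin N, ε i ω' • (√(N : ℝ) •
          Matrix.toEuclideanCLM (𝕜 := ℝ) (invSqrt V) (coef α (fun i => X i ω) (B ω) m i)) := by
  have h := condDistrib_comp_thetaHat (θ := θ) (ϑ₀ := ϑ₀) hX hε hB hind α m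
    (F := fun u => √(N : ℝ) • Matrix.toEuclideanCLM (𝕜 := ℝ) (invSqrt V) (u - θ))
    (Continuous.measurable (by fun_prop)) (measurable_standardized hX hε hB hϑ₀ α m V)
    -- Centering at the conditional mean is centering at `θ` here, so the standardized variable is a
    -- fixed function of the estimator.
    ((muHat_eq_of_contracting hX hε hB hϑ₀ hind hint h0 α m).mono fun ω h1 h2 => by
      rw [standardized, h1 h2])
  filter_upwards [h] with ω hω hc
  rw [hω hc]
  congr 1
  funext ω'
  simp only [add_sub_cancel_left, map_sum, Finset.smul_sum, map_smul]
  exact Finset.sum_congr rfl fun i _ => smul_comm _ _ _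

end Measurability

end FMGD

namespace FMGD

/-! ### Strong laws for changing mini-batches. -/

section StrongLaw

variable {p N M : ℕ}

lemma toEuclideanCLM_batchCov (x : Fin N → Vec p) (b : Fin N → Fin M) (k : Fin M) :
    batchCov x b k = Matrix.toEuclideanCLM (𝕜 := ℝ) (Matrix.of fun j l =>
      ((Finset.univ.filter fun i => b i = k).card : ℝ)⁻¹ *
        ∑ i ∈ Finset.univ.filter fun i => b i = k, x i j * x i l) := by
  ext u j
  rw [batchCov_apply, Matrix.ofLp_toEuclideanCLM]
  simp only [PiLp.smul_apply, WithLp.ofLp_sum, Finset.sum_apply, WithLp.ofLp_smul, Pi.smul_apply,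
    smul_eq_mul, Matrix.mulVec, dotProduct, Matrix.of_apply, PiLp.inner_apply,
    RCLike.inner_apply, conj_trivial, Finset.mul_sum, Finset.sum_mul]
  rw [Finset.sum_comm]
  refine Finset.sum_congr rfl fun l _ => Finset.sum_congr rfl fun i _ => ?_
  ring

lemma tendsto_batchCov {x : ∀ n, Fin (n * M) → Vec p} {b : ∀ n, Fin (n * M) → Fin M}
    (hcard : ∀ n k, (Finset.univ.filter fun i => b n i = k).card = n) {k : Fin M}
    {A : Matrix (Fin p) (Fin p) ℝ}
    (h : ∀ j l, Tendsto (fun n : ℕ => (n : ℝ)⁻¹ * ∑ i ∈ Finset.univ.filter fun i => b n i = k,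
      (x n i j * x n i l - A j l)) atTop (𝓝 0)) :
    Tendsto (fun n => batchCov (x n) (b n) k) atTop (𝓝 (Matrix.toEuclideanCLM (𝕜 := ℝ) A)) := by
  simp only [toEuclideanCLM_batchCov, hcard]
  have hc : Continuous (Matrix.toEuclideanCLM (n := Fin p) (𝕜 := ℝ)) :=
    LinearMap.continuous_of_finiteDimensional
      (Matrix.toEuclideanCLM (n := Fin p) (𝕜 := ℝ)).toAlgEquiv.toLinearMap
  refine (hc.tendsto A).comp (tendsto_pi_nhds.2 fun j => tendsto_pi_nhds.2 fun l => ?_)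
  have h1 := (h j l).add_const (A j l)
  rw [zero_add] at h1
  refine h1.congr' ?_
  filter_upwards [eventually_ne_atTop 0] with n hn
  have hn : (n : ℝ) ≠ 0 := by exact_mod_cast hn
  rw [Finset.sum_sub_distrib, Finset.sum_const, hcard, nsmul_eq_mul, mul_sub,
    inv_mul_cancel_left₀ hn, sub_add_cancel]
  rfl

variable {Ω : Type*} [MeasurableSpace Ω] {P : Measure Ω} [IsProbabilityMeasure P]

/-- A strong law of large numbers for the averages over mini-batches that are chosen anew,
independently of the data, for every sample size. -/
lemma ae_tendsto_batch_average {Z : ℕ → Ω → ℝ} (hind : iIndepFun Z P)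
    (hZ : ∀ i, Measurable (Z i)) (hident : ∀ i, IdentDistrib (Z i) (Z 0) P P)
    (h4 : MemLp (Z 0) 4 P) (h0 : ∫ ω, Z 0 ω ∂P = 0)
    {B : (n : ℕ) → Ω → Fin (n * M) → Fin M} (hB : ∀ n, Measurable (B n))
    (hBcard : ∀ n ω m, (Finset.univ.filter fun i => B n ω i = m).card = n)
    (hBindep : ∀ n, IndepFun (B n) (fun ω (i : Fin (n * M)) => Z i ω) P) (k : Fin M) :
    ∀ᵐ ω ∂P, Tendsto (fun n : ℕ => (n : ℝ)⁻¹ * ∑ i ∈ Finset.univ.filter fun i => B n ω i = k,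
      Z i ω) atTop (𝓝 0) := by
  set A := ∫ ω, Z 0 ω ^ 2 ∂P with hA
  set C := ∫ ω, Z 0 ω ^ 4 ∂P with hC
  have h4' : ∀ i, MemLp (Z i) 4 P := fun i => (hident i).memLp_iff.2 h4
  have hA' : ∀ i, ∫ ω, Z i ω ^ 2 ∂P ≤ A := fun i =>
    ((hident i).comp (u := fun y : ℝ => y ^ 2) (by fun_prop)).integral_eq.le
  have hC' : ∀ i, ∫ ω, Z i ω ^ 4 ∂P ≤ C := fun i =>
    ((hident i).comp (u := fun y : ℝ => y ^ 4) (by fun_prop)).integral_eq.le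
  have h0' : ∀ i, ∫ ω, Z i ω ∂P = 0 := fun i => (hident i).integral_eq.trans h0
  have hC0 : 0 ≤ C := integral_nonneg fun _ => by positivity
  let F : ∀ n : ℕ, (Fin (n * M) → Fin M) × (Fin (n * M) → ℝ) → ENNReal := fun n q =>
    ENNReal.ofReal (((n : ℝ)⁻¹ * ∑ i ∈ Finset.univ.filter fun i => q.1 i = k, q.2 i) ^ 4)
  have hF : ∀ n, Measurable (F n) := fun n => by
    refine measurable_from_prod_countable_right fun b => ?_
    simp only [F]
    fun_prop
  have hZm : ∀ n, Measurable fun ω (i : Fin (n * M)) => Z i ω := fun n =>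
    measurable_pi_lambda _ fun i => hZ i
  -- For frozen labels the fourth moment of an average of `n` terms is `O(n⁻²)`, uniformly in the
  -- labels. Summability over `n` then needs no relation between the batches of different sample
  -- sizes.
  have hbound : ∀ n, ∫⁻ ω, F n (B n ω, fun i => Z i ω) ∂P ≤
      ENNReal.ofReal ((C + 3 * A ^ 2) * (1 / (n : ℝ) ^ 2)) := by
    intro n
    refine lintegral_comp_le_of_indepFun (hB n) (hZm n) (hF n) (hBindep n) fun ω => ?_
    simp only [F]
    have h5 := (integral_sum_pow_four_le
      (hind.precomp (g := fun i : Fin (n * M) => (i : ℕ)) Fin.val_injective) (fun i => hZ i)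
      (fun i => h4' i) (fun i => h0' i) (fun i => hA' i) (fun i => hC' i)
      (Finset.univ.filter fun i => B n ω i = k)).2
    rw [hBcard] at h5
    have hS : MemLp (fun ω' => ∑ i ∈ Finset.univ.filter fun i => B n ω i = k, Z i ω')
        (4 : ℕ) P := memLp_finsetSum _ fun i _ => by exact_mod_cast h4' i
    have hint : Integrable (fun ω' => ((n : ℝ)⁻¹ *
        ∑ i ∈ Finset.univ.filter fun i => B n ω i = k, Z i ω') ^ 4) P := by
      simp only [mul_pow]
      refine Integrable.const_mul ?_ _
      simpa using integrable_pow_mul_pow hS hS (a := 4) (b := 0) le_rfl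
    rw [← ofReal_integral_eq_lintegral_ofReal hint (ae_of_all _ fun _ => by positivity)]
    refine ENNReal.ofReal_le_ofReal ?_
    simp only [mul_pow]
    rw [integral_const_mul]
    rcases Nat.eq_zero_or_pos n with rfl | hn
    · simp
    have hn : (1 : ℝ) ≤ n := by exact_mod_cast hn
    calc _ ≤ ((n : ℝ)⁻¹) ^ 4 * (n * C + 3 * (n * A) ^ 2) := by gcongr
      _ ≤ ((n : ℝ)⁻¹) ^ 4 * ((n : ℝ) ^ 2 * C + 3 * (n * A) ^ 2) := by
        gcongr
        nlinarith
      _ = _ := by field_simp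
  have hsum : ∑' n, ∫⁻ ω, F n (B n ω, fun i => Z i ω) ∂P ≠ ⊤ := by
    have h6 : Summable fun n : ℕ => (C + 3 * A ^ 2) * (1 / (n : ℝ) ^ 2) :=
      (Real.summable_one_div_nat_pow.2 one_lt_two).mul_left _
    exact ne_top_of_le_ne_top h6.tsum_ofReal_ne_top (ENNReal.tsum_le_tsum hbound)
  filter_upwards [ae_tendsto_zero_of_tsum_lintegral_ne_top
    (fun n => (hF n).comp ((hB n).prodMk (hZm n))) hsum] with ω hω
  have h7 := (ENNReal.tendsto_toReal ENNReal.zero_ne_top).comp hω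
  have h8 : Tendsto (fun n : ℕ => ((n : ℝ)⁻¹ *
      ∑ i ∈ Finset.univ.filter fun i => B n ω i = k, Z i ω) ^ 4) atTop (𝓝 0) := by
    refine h7.congr fun n => ?_
    simp only [Function.comp, F]
    exact ENNReal.toReal_ofReal (by positivity)
  have h9 := h8.sqrt.sqrt
  simp only [Real.sqrt_zero] at h9
  rw [tendsto_zero_iff_abs_tendsto_zero]
  refine h9.congr fun n => ?_
  rw [show 4 = 2 * 2 by norm_num, pow_mul, Real.sqrt_sq (sq_nonneg _), Real.sqrt_sq_eq_abs]
  rfl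

/-- The largest of `n * M` identically distributed variables with finite eighth moments is `o (√n)`,
almost surely. -/
lemma ae_eventually_abs_le_sqrt {Z : ℕ → Ω → ℝ} (hZ : ∀ i, Measurable (Z i))
    (hident : ∀ i, IdentDistrib (Z i) (Z 0) P P) (h8 : MemLp (Z 0) 8 P) (M : ℕ) :
    ∀ᵐ ω ∂P, ∀ η : ℝ, 0 < η → ∀ᶠ n : ℕ in atTop, ∀ i < n * M, |Z i ω| ≤ η * √n := by
  set C := ∫ ω, Z 0 ω ^ 8 ∂P with hC
  have hint : ∀ i, Integrable (fun ω => Z i ω ^ 8) P := fun i => by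
    have h := (hident i).memLp_iff.2 h8
    have h' : MemLp (Z i) (8 : ℕ) P := by exact_mod_cast h
    simpa using integrable_pow_mul_pow h' h' (a := 8) (b := 0) le_rfl
  have hC' : ∀ i, ∫ ω, Z i ω ^ 8 ∂P = C := fun i =>
    ((hident i).comp (u := fun y : ℝ => y ^ 8) (by fun_prop)).integral_eq
  -- The expectation is `M C n⁻³`, which is summable, while `W n ω ≤ η ^ 8` forces every `|Z i ω|`
  -- below `η √n`.
  let W : ℕ → Ω → ENNReal := fun n ω =>
    ENNReal.ofReal (((n : ℝ)⁻¹) ^ 4 * ∑ i ∈ Finset.range (n * M), Z i ω ^ 8)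
  have hW : ∀ n, Measurable (W n) := fun n => by simp only [W]; fun_prop
  have hsum : ∑' n, ∫⁻ ω, W n ω ∂P ≠ ⊤ := by
    have h6 : Summable fun n : ℕ => (M * C) * (1 / (n : ℝ) ^ 3) :=
      (Real.summable_one_div_nat_pow.2 (by norm_num)).mul_left _
    refine ne_top_of_le_ne_top h6.tsum_ofReal_ne_top (ENNReal.tsum_le_tsum fun n => ?_)
    rw [← ofReal_integral_eq_lintegral_ofReal
      ((integrable_finsetSum _ fun i _ => hint i).const_mul _)
      (ae_of_all _ fun ω => mul_nonneg (by positivity) (Finset.sum_nonneg fun i _ => by positivity))]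
    refine ENNReal.ofReal_le_ofReal (le_of_eq ?_)
    rw [integral_const_mul, integral_finsetSum _ fun i _ => hint i]
    simp only [hC', Finset.sum_const, Finset.card_range, nsmul_eq_mul]
    rcases Nat.eq_zero_or_pos n with rfl | hn
    · simp
    push_cast
    field_simp
  filter_upwards [ae_tendsto_zero_of_tsum_lintegral_ne_top hW hsum] with ω hω η hη
  have h7 : ∀ᶠ n in atTop, W n ω ≤ ENNReal.ofReal (η ^ 8) :=
    (hω.eventually_lt_const (ENNReal.ofReal_pos.2 (by positivity))).mono fun n h => h.le
  filter_upwards [h7, eventually_gt_atTop 0] with n hn hn0 i hi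
  have hn0 : (0 : ℝ) < n := by exact_mod_cast hn0
  rw [ENNReal.ofReal_le_ofReal_iff (by positivity)] at hn
  have h9 : Z i ω ^ 8 ≤ ∑ i ∈ Finset.range (n * M), Z i ω ^ 8 :=
    Finset.single_le_sum (f := fun i => Z i ω ^ 8) (fun j _ => by positivity)
      (Finset.mem_range.2 hi)
  have h10 : |Z i ω| ^ 8 ≤ (η * √(n : ℝ)) ^ 8 := by
    have h11 : (√(n : ℝ)) ^ 8 = (n : ℝ) ^ 4 := by
      rw [show 8 = 2 * 4 by norm_num, pow_mul, Real.sq_sqrt hn0.le]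
    rw [mul_pow, h11, show |Z i ω| ^ 8 = Z i ω ^ 8 from Even.pow_abs (by decide) _]
    rw [inv_pow, inv_mul_le_iff₀ (by positivity)] at hn
    linarith
  exact le_of_pow_le_pow_left₀ (by norm_num) (by positivity) h10

lemma memLp_four_mul {X Y : Ω → ℝ} (hX : MemLp X 8 P) (hY : MemLp Y 8 P) :
    MemLp (fun ω => X ω * Y ω) 4 P := by
  have hX' : MemLp X (8 : ℕ) P := by exact_mod_cast hX
  have hY' : MemLp Y (8 : ℕ) P := by exact_mod_cast hY
  have h := integrable_pow_mul_pow hX' hY' (a := 4) (b := 4) le_rfl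
  rw [← integrable_norm_rpow_iff (f := fun ω => X ω * Y ω) (hX.1.mul hY.1) (by norm_num)
    (by norm_num)]
  refine h.congr (ae_of_all _ fun ω => ?_)
  have : (4 : ENNReal).toReal = ((4 : ℕ) : ℝ) := by norm_num
  change X ω ^ 4 * Y ω ^ 4 = ‖X ω * Y ω‖ ^ (4 : ENNReal).toReal
  rw [this, Real.rpow_natCast, Real.norm_eq_abs]
  rw [Even.pow_abs (by decide), mul_pow]

end StrongLaw

end FMGD

namespace FMGD

/-! ### Almost sure behavior of the design. -/

section Design

variable {p M : ℕ} {Ω : Type*} [MeasurableSpace Ω] {P : Measure Ω} [IsProbabilityMeasure P]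
  {X : ℕ → Ω → Vec p} {B : (n : ℕ) → Ω → Fin (n * M) → Fin M}

lemma ae_tendsto_batchCov (hX : ∀ i, Measurable (X i)) (hind : iIndepFun X P)
    (hident : ∀ i, IdentDistrib (X i) (X 0) P P) (h8 : ∀ j, MemLp (fun ω => X 0 ω j) 8 P)
    (hB : ∀ n, Measurable (B n))
    (hBcard : ∀ n ω m, (Finset.univ.filter fun i => B n ω i = m).card = n)
    (hBindep : ∀ n, IndepFun (B n) (fun ω (i : Fin (n * M)) => X i ω) P) :
    ∀ᵐ ω ∂P, ∀ k, Tendsto (fun n => batchCov (fun i : Fin (n * M) => X i ω) (B n ω) k) atTop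
      (𝓝 (Matrix.toEuclideanCLM (𝕜 := ℝ) (secondMoment P X))) := by
  have hu : ∀ j l : Fin p, Measurable fun y : Vec p => y j * y l - secondMoment P X j l :=
    fun j l => by fun_prop
  have h : ∀ k : Fin M, ∀ j l : Fin p, ∀ᵐ ω ∂P, Tendsto (fun n : ℕ => (n : ℝ)⁻¹ *
      ∑ i ∈ Finset.univ.filter fun i => B n ω i = k,
        (X i ω j * X i ω l - secondMoment P X j l)) atTop (𝓝 0) := by
    intro k j l
    have hprod : MemLp (fun ω => X 0 ω j * X 0 ω l) 4 P := memLp_four_mul (h8 j) (h8 l)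
    refine ae_tendsto_batch_average
      (Z := fun i ω => X i ω j * X i ω l - secondMoment P X j l)
      (hind.comp (fun _ y => y j * y l - secondMoment P X j l) fun _ => hu j l)
      (fun i => (hu j l).comp (hX i)) (fun i => (hident i).comp (hu j l))
      (hprod.sub (memLp_const _)) ?_ hB hBcard (fun n => ?_) k
    · rw [integral_sub (hprod.integrable (by norm_num)) (integrable_const _)]
      simp [secondMoment]
    · exact (hBindep n).comp (φ := id)
        (ψ := fun y (i : Fin (n * M)) => y i j * y i l - secondMoment P X j l) measurable_id
        (measurable_pi_lambda _ fun i => (hu j l).comp (measurable_pi_apply i))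
  have h' := ae_all_iff.2 fun k => ae_all_iff.2 fun j => ae_all_iff.2 fun l => h k j l
  filter_upwards [h'] with ω hω k
  exact tendsto_batchCov (fun n k => hBcard n ω k) (hω k)

lemma ae_eventually_norm_le_sqrt (hX : ∀ i, Measurable (X i))
    (hident : ∀ i, IdentDistrib (X i) (X 0) P P) (h8 : ∀ j, MemLp (fun ω => X 0 ω j) 8 P) (M : ℕ) :
    ∀ᵐ ω ∂P, ∀ η : ℝ, 0 < η → ∀ᶠ n : ℕ in atTop, ∀ i : Fin (n * M), ‖X i ω‖ ≤ η * √n := by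
  have h := ae_all_iff.2 fun j : Fin p => ae_eventually_abs_le_sqrt (Z := fun i ω => X i ω j)
    (fun i => by have := hX i; fun_prop)
    (fun i => (hident i).comp (u := fun y : Vec p => y j) (by fun_prop)) (h8 j) M
  filter_upwards [h] with ω hω η hη
  -- Summing `p` squared coordinates costs a factor `p / (p + 1) ^ 2 ≤ 1`; the denominator `p + 1`
  -- is never zero.
  filter_upwards [eventually_all.2 fun j => hω j (η / (p + 1)) (by positivity)] with n hn i
  have h1 : ‖X i ω‖ ^ 2 ≤ (η * √(n : ℝ)) ^ 2 := by
    rw [EuclideanSpace.norm_sq_eq]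
    calc ∑ j, ‖X i ω j‖ ^ 2 ≤ ∑ _j : Fin p, (η / (p + 1) * √(n : ℝ)) ^ 2 :=
          Finset.sum_le_sum fun j _ => pow_le_pow_left₀ (norm_nonneg _) (hn j i i.2) 2
      _ = (p / (p + 1) ^ 2) * (η * √(n : ℝ)) ^ 2 := by
        rw [Finset.sum_const, Finset.card_univ, Fintype.card_fin, nsmul_eq_mul]
        field_simp
      _ ≤ 1 * (η * √(n : ℝ)) ^ 2 := by
        gcongr
        rw [div_le_one (by positivity)]
        have : (0 : ℝ) ≤ p := by positivity
        nlinarith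
      _ = _ := one_mul _
  exact le_of_pow_le_pow_left₀ two_ne_zero (by positivity) h1

lemma indepFun_design {ε : ℕ → Ω → ℝ} (hX : ∀ i, Measurable (X i)) (hε : ∀ i, Measurable (ε i))
    (hindep : iIndepFun (fun i ω => (X i ω, ε i ω)) P)
    (hident : ∀ i, IdentDistrib (fun ω => (X i ω, ε i ω)) (fun ω => (X 0 ω, ε 0 ω)) P P)
    (hXε : ∀ i, IndepFun (X i) (ε i) P) (hB : ∀ n, Measurable (B n))
    (hBindep : ∀ n, IndepFun (B n) (fun ω i => (X i ω, ε i ω)) P) (n : ℕ) :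
    IndepFun (design X (B n)) (fun ω (i : Fin (n * M)) => ε i ω) P := by
  have h1 : IndepFun (fun ω (i : Fin (n * M)) => X i ω) (fun ω (i : Fin (n * M)) => ε i ω) P :=
    indepFun_pi_of_iIndepFun_prodMk (fun i => hX i) (fun i => hε i)
      (hindep.precomp (g := fun i : Fin (n * M) => (i : ℕ)) Fin.val_injective)
      (fun i j => (hident i).map_eq.trans (hident j).map_eq.symm) (fun i => hXε i)
  have h2 : IndepFun (B n) (fun ω => ((fun (i : Fin (n * M)) => X i ω),
      fun (i : Fin (n * M)) => ε i ω)) P := by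
    have h3 : Measurable fun (q : ℕ → Vec p × ℝ) (i : Fin (n * M)) => (q i).1 :=
      measurable_pi_lambda _ fun i => (measurable_pi_apply (i : ℕ)).fst
    have h4 : Measurable fun (q : ℕ → Vec p × ℝ) (i : Fin (n * M)) => (q i).2 :=
      measurable_pi_lambda _ fun i => (measurable_pi_apply (i : ℕ)).snd
    exact (hBindep n).comp (φ := id) (ψ := fun (q : ℕ → Vec p × ℝ) =>
      ((fun (i : Fin (n * M)) => (q i).1), fun (i : Fin (n * M)) => (q i).2)) measurable_id
      (h3.prodMk h4)
  exact indepFun_prodMk_of_indepFun_prodMk (hB n)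
    (measurable_pi_lambda _ fun i => hX i) (measurable_pi_lambda _ fun i => hε i) h2 h1

/-- The probability that some update is not a contraction tends to zero. -/
lemma tendsto_measure_not_contracting (hX : ∀ i, Measurable (X i)) (hB : ∀ n, Measurable (B n))
    {α : ℝ} (h : ∀ᵐ ω ∂P, ∀ᶠ n in atTop, Contracting α (fun i : Fin (n * M) => X i ω) (B n ω)) :
    Tendsto (fun n => P.real {ω | ¬ Contracting α (fun i : Fin (n * M) => X i ω) (B n ω)}) atTop
      (𝓝 0) := by
  have h1 := tendsto_measure_of_ae_tendsto_indicator_of_isFiniteMeasure (μ := P) atTop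
    MeasurableSet.empty
    (As := fun n => {ω | ¬ Contracting α (fun i : Fin (n * M) => X i ω) (B n ω)})
    (fun n => (measurable_design hX (hB n) (measurableSet_contracting α)).compl)
    (h.mono fun ω hω => hω.mono fun n hn => by simp [hn])
  rw [measure_empty] at h1
  exact (ENNReal.tendsto_toReal ENNReal.zero_ne_top).comp h1

lemma eventually_contracting {A : Matrix (Fin p) (Fin p) ℝ} (hA : A.PosDef) {α : ℝ} (hα : 0 < α)
    (hα2 : α < 2 / lambdaMax A) {x : ∀ n, Fin (n * M) → Vec p} {b : ∀ n, Fin (n * M) → Fin M}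
    (hH : ∀ k, Tendsto (fun n => batchCov (x n) (b n) k) atTop
      (𝓝 (Matrix.toEuclideanCLM (𝕜 := ℝ) A))) :
    ∀ᶠ n in atTop, Contracting α (x n) (b n) := by
  refine eventually_all.2 fun k => ?_
  have h : Tendsto (fun n => ‖(1 : Vec p →L[ℝ] Vec p) - α • batchCov (x n) (b n) k‖) atTop _ :=
    (tendsto_const_nhds.sub ((hH k).const_smul α)).norm
  exact h.eventually_lt_const (norm_one_sub_smul_lt_one hA hα hα2)

end Design

/-! ### From conditional to unconditional convergence. -/

section Distribution

variable {Ω δ E : Type*} [MeasurableSpace Ω] [MeasurableSpace δ] {P : Measure Ω}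
  [IsProbabilityMeasure P] [NormedAddCommGroup E] [InnerProductSpace ℝ E] [FiniteDimensional ℝ E]
  [MeasurableSpace E] [BorelSpace E]

/-- The tower property for `exp (i ⟪Z, t⟫)`; the measurability is what dominated convergence needs.
-/
lemma charFun_map_eq_integral_condDistrib {D : Ω → δ} {Z : Ω → E} (hD : Measurable D)
    (hZ : Measurable Z) (t : E) :
    charFun (P.map Z) t = ∫ ω, charFun (condDistrib Z D P (D ω)) t ∂P ∧
      AEStronglyMeasurable (fun ω => charFun (condDistrib Z D P (D ω)) t) P := by
  have : IsProbabilityMeasure (P.map D) := Measure.isProbabilityMeasure_map hD.aemeasurable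
  let f : δ × E → ℂ := fun q => Complex.exp (⟪q.2, t⟫ * Complex.I)
  have hf : Measurable f := by
    have h2 : Continuous fun u : E => Complex.exp (⟪u, t⟫ * Complex.I) := by fun_prop
    exact h2.measurable.comp measurable_snd
  have hnorm : ∀ q, ‖f q‖ ≤ 1 := fun q => by
    simp only [f]; rw [Complex.norm_exp_ofReal_mul_I]
  have hmeas : StronglyMeasurable fun d => charFun (condDistrib Z D P d) t := by
    simp only [charFun_apply]
    exact StronglyMeasurable.integral_condDistrib (f := f) hf.stronglyMeasurable
  refine ⟨?_, (hmeas.comp_measurable hD).aestronglyMeasurable⟩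
  have h1 : (P.map D) ⊗ₘ condDistrib Z D P = P.map fun ω => (D ω, Z ω) :=
    compProd_map_condDistrib hZ.aemeasurable
  have h2 : ∫ q, f q ∂(P.map fun ω => (D ω, Z ω)) = charFun (P.map Z) t := by
    rw [integral_map (hD.prodMk hZ).aemeasurable hf.aestronglyMeasurable, charFun_apply,
      integral_map hZ.aemeasurable (by fun_prop)]
  rw [← h2, ← h1, Measure.integral_compProd
    (Integrable.of_bound hf.aestronglyMeasurable 1 (ae_of_all _ hnorm)),
    integral_map hD.aemeasurable]
  · simp only [charFun_apply, f]
  · have := hmeas.aestronglyMeasurable (μ := P.map D)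
    simpa only [charFun_apply] using this

/-- If the conditional distributions converge weakly to a deterministic limit, almost surely, then
so do the unconditional distributions. -/
lemma tendstoInDistribution_of_condDistrib {δ : ℕ → Type*} [∀ n, MeasurableSpace (δ n)]
    {D : ∀ n, Ω → δ n} {Z : ℕ → Ω → E} (hD : ∀ n, Measurable (D n)) (hZ : ∀ n, Measurable (Z n))
    {ν : Measure E} [IsProbabilityMeasure ν]
    (h : ∀ᵐ ω ∂P, Tendsto (β := ProbabilityMeasure E)
      (fun n => ⟨condDistrib (Z n) (D n) P (D n ω), inferInstance⟩) atTop
      (𝓝 ⟨ν, inferInstance⟩)) :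
    TendstoInDistribution Z atTop id (fun _ => P) ν where
  forall_aemeasurable n := (hZ n).aemeasurable
  tendsto := by
    refine ProbabilityMeasure.tendsto_iff_tendsto_charFun.2 fun t => ?_
    simp only [ProbabilityMeasure.coe_mk, Measure.map_id]
    have h1 : ∀ᵐ ω ∂P, Tendsto (fun n => charFun (condDistrib (Z n) (D n) P (D n ω)) t) atTop
        (𝓝 (charFun ν t)) := by
      filter_upwards [h] with ω hω
      exact ProbabilityMeasure.tendsto_iff_tendsto_charFun.1 hω t
    have h2 := tendsto_integral_of_dominated_convergence (fun _ => (1 : ℝ))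
      (fun n => (charFun_map_eq_integral_condDistrib (P := P) (hD n) (hZ n) t).2)
      (integrable_const _) (fun n => ae_of_all _ fun ω => norm_charFun_le_one t) h1
    simp only [integral_const, probReal_univ, one_smul] at h2
    refine h2.congr fun n => ?_
    exact (charFun_map_eq_integral_condDistrib (hD n) (hZ n) t).1.symm

end Distribution

/-! ### Asymptotic normality given the design, and the theorem. -/

section Normality

variable {p M : ℕ} [NeZero M] {A : Matrix (Fin p) (Fin p) ℝ}

/-- Asymptotic normality of the normalized linear form in the noise, for fixed designs. -/
lemma tendsto_map_sum_smul_coef {Ω : Type*} [MeasurableSpace Ω] {P : Measure Ω}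
    [IsProbabilityMeasure P] {ε : ℕ → Ω → ℝ} (hε : ∀ i, Measurable (ε i)) (hind : iIndepFun ε P)
    (hident : ∀ i, P.map (ε i) = P.map (ε 0)) (hL2 : MemLp (ε 0) 2 P)
    (h0 : ∫ ω, ε 0 ω ∂P = 0) {σ : ℝ} (hσ : ∫ ω, ε 0 ω ^ 2 ∂P = σ ^ 2)
    (hA : A.PosDef) {x : ∀ n, Fin (n * M) → Vec p} {b : ∀ n, Fin (n * M) → Fin M}
    (hcard : ∀ n k, (Finset.univ.filter fun i => b n i = k).card = n)
    (hH : ∀ k, Tendsto (fun n => batchCov (x n) (b n) k) atTop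
      (𝓝 (Matrix.toEuclideanCLM (𝕜 := ℝ) A)))
    (hx : ∀ η : ℝ, 0 < η → ∀ᶠ n : ℕ in atTop, ∀ i, ‖x n i‖ ≤ η * √n)
    {α : ℝ} (hα : 0 < α) (hα2 : α < 2 / lambdaMax A) (m : Fin M)
    (κ : ℕ → ProbabilityMeasure (Vec p))
    -- Eventual equality suffices, and the linear form describes the conditional law only once the
    -- design is contracting.
    (hκ : ∀ᶠ n in atTop, (κ n : Measure (Vec p)) =
      P.map fun ω => ∑ i : Fin (n * M), ε i ω • (√((n * M : ℕ) : ℝ) •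
        Matrix.toEuclideanCLM (𝕜 := ℝ) (invSqrt (asympVar M hA.1 α)) (coef α (x n) (b n) m i))) :
    Tendsto κ atTop (𝓝 ⟨multivariateGaussian 0 ((σ ^ 2) • 1), inferInstance⟩) := by
  have hV := posDef_asympVar (NeZero.ne M) hA hα hα2
  set V := asympVar M hA.1 α with hVdef
  set R := Matrix.toEuclideanCLM (n := Fin p) (𝕜 := ℝ) (invSqrt V) with hR
  have hRsa : ContinuousLinearMap.adjoint R = R := by
    rw [hR, ← ContinuousLinearMap.star_eq_adjoint, ← map_star, star_invSqrt]
  -- The self-adjoint `R` moves to the test vector, so the limit variance in direction `t` is the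
  -- form of `V` at `R t`.
  have hRV : ∀ t : Vec p, ⟪R t, Matrix.toEuclideanCLM (𝕜 := ℝ) V (R t)⟫ = ‖t‖ ^ 2 := by
    intro t
    rw [← hRsa, ContinuousLinearMap.adjoint_inner_left, hRsa, ← real_inner_self_eq_norm_sq]
    have h := congrArg (fun S => Matrix.toEuclideanCLM (n := Fin p) (𝕜 := ℝ) S)
      (invSqrt_mul_mul_invSqrt hV)
    simp only [map_mul, map_one] at h
    have h' := congrArg (fun S : Vec p →L[ℝ] Vec p => S t) h
    exact congrArg (fun u => ⟪t, u⟫) h'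
  have hS : ((σ ^ 2) • (1 : Matrix (Fin p) (Fin p) ℝ)).PosSemidef :=
    Matrix.PosSemidef.one.smul (sq_nonneg σ)
  refine ProbabilityMeasure.tendsto_iff_tendsto_charFun.2 fun t => ?_
  simp only [ProbabilityMeasure.coe_mk]
  have hlim : charFun (multivariateGaussian 0 ((σ ^ 2) • (1 : Matrix (Fin p) (Fin p) ℝ))) t =
      Complex.exp (((-(σ ^ 2 / 2 * ‖t‖ ^ 2) : ℝ) : ℂ)) := by
    rw [charFun_multivariateGaussian hS, inner_zero_right, Matrix.smul_mulVec, Matrix.one_mulVec,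
      dotProduct_smul, EuclideanSpace.norm_sq_eq]
    congr 1
    simp only [dotProduct, Real.norm_eq_abs, sq_abs, smul_eq_mul, ← sq]
    push_cast
    ring
  rw [hlim]
  have hc : ∀ n (i : Fin (n * M)), ⟪√((n * M : ℕ) : ℝ) • R (coef α (x n) (b n) m i), t⟫ =
      ⟪√((n * M : ℕ) : ℝ) • coef α (x n) (b n) m i, R t⟫ := by
    intro n i
    rw [← map_smul, ← ContinuousLinearMap.adjoint_inner_right, hRsa]
  have hmain := tendsto_charFun_sum_smul hε hind hident hL2 h0 hσ (N := fun n => n * M)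
    (fun n i => √((n * M : ℕ) : ℝ) • R (coef α (x n) (b n) m i)) (t := t) (v := ‖t‖ ^ 2)
    (by
      simp only [hc]
      rw [← hRV]
      exact tendsto_sum_coef_sq hA hcard hH hα hα2 m (R t))
    (fun η hη => by
      simp only [hc]
      exact eventually_abs_inner_coef_le hA hcard hH hx hα hα2 m (R t) hη)
  refine hmain.congr' ?_
  filter_upwards [hκ] with n hn
  rw [hn]

end Normality

end FMGD

end

theorem theorem2
    {Ω : Type*} [MeasurableSpace Ω] (P : Measure Ω) [IsProbabilityMeasure P]
    (p M : ℕ) [NeZero M]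
    -- The samples: independent and identically distributed pairs of covariates and noise.
    (X : ℕ → Ω → FMGD.Vec p) (ε : ℕ → Ω → ℝ) (θ : FMGD.Vec p) (σ : ℝ)
    (hX : ∀ i, Measurable (X i)) (hε : ∀ i, Measurable (ε i))
    (hindep : iIndepFun (fun i ω => (X i ω, ε i ω)) P)
    (hident : ∀ i, IdentDistrib (fun ω => (X i ω, ε i ω)) (fun ω => (X 0 ω, ε 0 ω)) P P)
    -- The noise is independent of the covariates, has mean zero and variance `σ ^ 2`.
    (hXε : ∀ i, IndepFun (X i) (ε i) P)
    (hεL2 : ∀ i, MemLp (ε i) 2 P) (hεmean : ∀ i, ∫ ω, ε i ω ∂P = 0)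
    (hεvar : ∀ i, variance (ε i) P = σ ^ 2)
    -- The entries of the covariates are sub-gaussian.
    (hsub : ∃ K : ℝ, 0 < K ∧ ∀ (i : ℕ) (j : Fin p) (u : ℝ), 0 < u →
      P.real {ω | u < |X i ω j|} ≤ Real.exp (1 - u ^ 2 / K ^ 2))
    (hpos : (FMGD.secondMoment P X).PosDef)
    -- For every `n`, the sample of size `n * M` is divided into `M` mini-batches of size `n`,
    -- at random (or not) but independently of the data.
    (B : (n : ℕ) → Ω → Fin (n * M) → Fin M) (hB : ∀ n, Measurable (B n))
    (hBcard : ∀ n ω m, (Finset.univ.filter fun i => B n ω i = m).card = n)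
    (hBindep : ∀ n, IndepFun (B n) (fun ω i => (X i ω, ε i ω)) P)
    -- The initial values of the algorithm are arbitrary, possibly random.
    (ϑ₀ : ℕ → Ω → FMGD.Vec p) (hϑ₀ : ∀ n, Measurable (ϑ₀ n)) :
    ∃ v : Fin M → ℝ → Matrix (Fin p) (Fin p) ℝ, ∀ m : Fin M,
      -- The expansion of `v` as the learning rate tends to zero.
      (∀ j k, (fun α : ℝ => v m α j k -
          ((FMGD.secondMoment P X)⁻¹ +
            (α ^ 2 * ((M : ℝ) ^ 2 - 1) / 12) • FMGD.secondMoment P X) j k)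
        =o[𝓝[>] 0] fun α : ℝ => α ^ 2) ∧
      -- The conditional mean is `θ + O_p(α ^ 2 * n ^ (-3 / 2))`, uniformly on `(0, a]`.
      (∀ a : ℝ, 0 < a → a < 2 / FMGD.lambdaMax (FMGD.secondMoment P X) →
        ∀ δ : ℝ, 0 < δ → ∃ C : ℝ, ∀ᶠ n : ℕ in atTop, ∀ α : ℝ, 0 < α → α ≤ a →
          P.real {ω | C * (α ^ 2 * (n : ℝ) ^ (-(3 / 2) : ℝ)) <
            ‖FMGD.muHat P X ε θ (B n) (ϑ₀ n) α m ω - θ‖} ≤ δ) ∧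
      ∀ α : ℝ, 0 < α → α < 2 / FMGD.lambdaMax (FMGD.secondMoment P X) →
        (v m α).PosDef ∧
        -- Convergence in distribution.
        TendstoInDistribution
          (fun n => FMGD.standardized P X ε θ (B n) (ϑ₀ n) α m (v m α)) atTop id
          (fun _ => P) (multivariateGaussian 0 ((σ ^ 2) • 1)) ∧
        -- Almost sure weak convergence of the conditional distributions, given the covariates
        -- and the mini-batches.
        ∀ᵐ ω ∂P, Tendsto (β := ProbabilityMeasure (FMGD.Vec p))
          (fun n => ⟨condDistrib (FMGD.standardized P X ε θ (B n) (ϑ₀ n) α m (v m α))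
            (FMGD.design X (B n)) P (FMGD.design X (B n) ω), inferInstance⟩) atTop
          (𝓝 ⟨multivariateGaussian 0 ((σ ^ 2) • 1), inferInstance⟩) := by
  have hM : M ≠ 0 := NeZero.ne M
  have hXind : iIndepFun X P := hindep.comp (fun _ => Prod.fst) fun _ => measurable_fst
  have hεind : iIndepFun ε P := hindep.comp (fun _ => Prod.snd) fun _ => measurable_snd
  have hXident : ∀ i, IdentDistrib (X i) (X 0) P P := fun i => (hident i).comp measurable_fst
  have hεident : ∀ i, P.map (ε i) = P.map (ε 0) := fun i =>
    ((hident i).comp measurable_snd).map_eq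
  -- The strong law is applied to products of two entries and uses their fourth moments, hence
  -- eighth moments of the entries.
  have hX8 : ∀ j, MemLp (fun ω => X 0 ω j) 8 P := by
    obtain ⟨K, hK, hsub⟩ := hsub
    intro j
    have hXj : Measurable fun ω => X 0 ω j := by have := hX 0; fun_prop
    exact_mod_cast memLp_of_gaussian_tail hXj hK (hsub 0 j) (q := 8) (by norm_num)
  have hεint : ∀ i, Integrable (ε i) P := fun i => (hεL2 i).integrable one_le_two
  have hσ : ∫ ω, ε 0 ω ^ 2 ∂P = σ ^ 2 := by
    rw [← variance_of_integral_eq_zero (hε 0).aemeasurable (hεmean 0), hεvar]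
  have hdes := FMGD.indepFun_design hX hε hindep hident hXε hB hBindep
  have hH := FMGD.ae_tendsto_batchCov hX hXind hXident hX8 hB hBcard fun n =>
    (hBindep n).comp (φ := id) (ψ := fun (q : ℕ → FMGD.Vec p × ℝ) (i : Fin (n * M)) => (q i).1)
      measurable_id (measurable_pi_lambda _ fun i => (measurable_pi_apply (i : ℕ)).fst)
  have hx := FMGD.ae_eventually_norm_le_sqrt hX hXident hX8 M
  refine ⟨fun _ α => FMGD.asympVar M hpos.1 α, fun m =>
    ⟨FMGD.isLittleO_asympVar hM hpos, fun a ha ha2 δ hδ => ?_, fun α hα hα2 => ?_⟩⟩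
  · -- The conditional mean equals `θ` exactly for contracting designs, so every constant will do.
    refine ⟨0, ?_⟩
    -- Contraction is required at the largest rate `a` only, so the threshold for `n` does not
    -- depend on `α`.
    have hcontr := hH.mono fun ω hω => FMGD.eventually_contracting hpos ha ha2 hω
    filter_upwards [(FMGD.tendsto_measure_not_contracting hX hB hcontr).eventually_lt_const hδ]
      with n hn α hα hαa
    refine le_trans ?_ hn.le
    refine ENNReal.toReal_mono (measure_ne_top _ _) (measure_mono_ae ?_)
    filter_upwards [FMGD.muHat_eq_of_contracting (θ := θ) hX hε (hB n) (hϑ₀ n) (hdes n) hεint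
      hεmean α m] with ω hω h1 h2
    have h3 : 0 < ‖FMGD.muHat P X ε θ (B n) (ϑ₀ n) α m ω - θ‖ := by
      rw [zero_mul] at h1; exact h1
    rw [hω (h2.mono hα hαa), sub_self, norm_zero] at h3
    exact lt_irrefl _ h3
  · have hcond : ∀ᵐ ω ∂P, Tendsto (β := ProbabilityMeasure (FMGD.Vec p))
          (fun n => ⟨condDistrib (FMGD.standardized P X ε θ (B n) (ϑ₀ n) α m
              (FMGD.asympVar M hpos.1 α))
            (FMGD.design X (B n)) P (FMGD.design X (B n) ω), inferInstance⟩) atTop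
          (𝓝 ⟨multivariateGaussian 0 ((σ ^ 2) • 1), inferInstance⟩) := by
      have h1 := ae_all_iff.2 fun n => FMGD.condDistrib_standardized (θ := θ) hX hε (hB n) (hϑ₀ n)
        (hdes n) hεint hεmean α m (FMGD.asympVar M hpos.1 α)
      filter_upwards [h1, hH, hx] with ω h1 hH hx
      refine FMGD.tendsto_map_sum_smul_coef hε hεind hεident (hεL2 0) (hεmean 0) hσ hpos
        (fun n k => hBcard n ω k) hH hx hα hα2 m _ ?_
      filter_upwards [FMGD.eventually_contracting hpos hα hα2 hH] with n hn
      exact h1 n hn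
    exact ⟨FMGD.posDef_asympVar hM hpos hα hα2,
      FMGD.tendstoInDistribution_of_condDistrib (fun n => FMGD.measurable_design hX (hB n))
        (fun n => FMGD.measurable_standardized hX hε (hB n) (hϑ₀ n) α m _) hcond, hcond⟩
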